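/- Let $n\ge 2$ and $k,m\ge 0$. A cabled linkage $\mathcal L$ in $\mathbb R^n$ consists of a finite simple graph with vertex set $\mathcal V$ and edge set $\mathcal E$, a length $\ell(e)>0$ for each $e\in\mathcal E$, a set $V\subset\mathcal V$ of fixed vertices with a map $\mu\colon V\to\mathbb R^n$, and a set $F\subset\mathcal E$ of flexible edges; it is classical if $F=\emptyset$. Its configuration space $\mathcal C(\mathcal L)\subset(\mathbb R^n)^{\mathcal V}$ is the set of all $\varphi\colon\mathcal V\to\mathbb R^n$ such that $\varphi(v)=\mu(v)$ for $v\in V$, $|\varphi(v)-\varphi(w)|\le\ell(vw)$ for $vw\in F$, and $|\varphi(v)-\varphi(w)|=\ell(vw)$ for $vw\in\mathcal E\setminus F$. An analytic isomorphism between subsets $X\subset\mathbb R^a$ and $Y\subset\mathbb R^b$ is a bijection $X\to Y$ such that it and its inverse are restrictions of real analytic maps defined on open neighbourhoods of $X$ and of $Y$. Given $f\colon(\mathbb R^n)^k\to(\mathbb R^n)^m$ and vertices $w_1,\dots,w_k$ (inputs) and $v_1,\dots,v_m$ (outputs) of $\mathcal L$, put $q(\varphi)=(\varphi(w_1),\dots,\varphi(w_k))$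 and $p(\varphi)=(\varphi(v_1),\dots,\varphi(v_m))$ for $\varphi\in\mathcal C(\mathcal L)$. Suppose that $p=f\circ q$ on $\mathcal C(\mathcal L)$, and let $U\subset q(\mathcal C(\mathcal L))$. - $\mathcal L$ is functional for $f$ with restricted domain $U$ if $q$ restricts to an analytically trivial finite covering $q^{-1}(U)\to U$, i.e. there are a finite set $S\subset\mathbb R$ and an analytic isomorphism $\sigma\colon U\times S\to q^{-1}(U)$ with $q(\sigma(x,s))=x$ for all $(x,s)\in U\times S$. (So over $U$ the configuration space is a finite number of copies of the graph of $f$.) - $\mathcal L$ is strongly functional for $f$ with restricted domain $U$ if $q\colon\mathcal C(\mathcal L)\to q(\mathcal C(\mathcal L))$ is an analytic isomorphism. **Theorem.** Let $f\colon(\mathbb R^n)^k\to(\mathbb R^n)^m$ be a polynomial map, with $n\ge 2$, and let $K\subset(\mathbb R^n)^k$ be compact. Then there is a classical linkage that is functional for $f$ with restricted domain $K$, and there is a cabled linkage that is strongly functional for $f$ with restricted domain $K$. Moreover, each of these two linkages can be chosen so that its $k+m$ input and output vertices are pairwise distinct. -/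

import Mathlib

/-- A cabled linkage in `ℝⁿ` with (finite) vertex set `V`: a finite one dimensional
simplicial complex (a finite simple graph) with positive edge lengths, a set `fixed` of vertices together with the points where they are
fixed, and a set `flexible` of edges. Values of `length` off the edges and values of `position`
off the fixed vertices carry no information. -/
structure CabledLinkage (n : ℕ) (V : Type) [Fintype V] where
  graph : SimpleGraph V
  length : Sym2 V → ℝ
  length_pos : ∀ e ∈ graph.edgeSet, 0 < length e
  fixed : Set V
  position : V → EuclideanSpace ℝ (Fin n)
  flexible : Set (Sym2 V)
  flexible_subset : flexible ⊆ graph.edgeSet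

/-- `f` restricted to `X` is an analytic isomorphism onto `Y`: a bijection `X → Y` such that it and
its inverse are restrictions of maps that are analytic on open neighbourhoods of `X` and `Y`. -/
structure IsAnalyticIso {E F : Type*} [NormedAddCommGroup E] [NormedSpace ℝ E]
    [NormedAddCommGroup F] [NormedSpace ℝ F] (f : E → F) (X : Set E) (Y : Set F) : Prop where
  bijOn : Set.BijOn f X Y
  analytic : ∃ f' : E → F, AnalyticOnNhd ℝ f' X ∧ Set.EqOn f' f X
  analytic_inverse : ∃ g : F → E, AnalyticOnNhd ℝ g Y ∧ Set.LeftInvOn g f X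

/-- Over `U`, the map `q : C → B` is an analytically trivial finite covering: there are a finite
set `S` (of reals) and an analytic isomorphism `σ` of `U × S` onto the part of `C` over `U`
such that `q ∘ σ` is the projection to `U`. -/
def IsAnalyticallyTrivialCover {E B : Type*} [NormedAddCommGroup E] [NormedSpace ℝ E]
    [NormedAddCommGroup B] [NormedSpace ℝ B] (q : E → B) (C : Set E) (U : Set B) : Prop :=
  ∃ (S : Set ℝ) (σ : B × ℝ → E), S.Finite ∧ IsAnalyticIso σ (U ×ˢ S) (C ∩ q ⁻¹' U) ∧
    ∀ z ∈ U ×ˢ S, q (σ z) = z.1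

/-- Every real coordinate of `f : (ℝⁿ)ᵏ → (ℝⁿ)ᵐ` is a polynomial in the real coordinates of the
argument. -/
def IsPolynomialMap {n k m : ℕ}
    (f : (Fin k → EuclideanSpace ℝ (Fin n)) → (Fin m → EuclideanSpace ℝ (Fin n))) : Prop :=
  ∃ P : Fin m → Fin n → MvPolynomial (Fin k × Fin n) ℝ,
    ∀ x j i, f x j i = MvPolynomial.eval (fun p : Fin k × Fin n => x p.1 p.2) (P j i)

namespace CabledLinkage

/-- A classical linkage is one without flexible edges. -/
def IsClassical {n : ℕ} {V : Type} [Fintype V] (L : CabledLinkage n V) : Prop := L.flexible = ∅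

/-- The configuration space of all realizations. -/
def configSpace {n : ℕ} {V : Type} [Fintype V] (L : CabledLinkage n V) :
    Set (V → EuclideanSpace ℝ (Fin n)) :=
  {φ | (∀ v ∈ L.fixed, φ v = L.position v) ∧
    (∀ v w, s(v, w) ∈ L.flexible → dist (φ v) (φ w) ≤ L.length s(v, w)) ∧
    (∀ v w, s(v, w) ∈ L.graph.edgeSet \ L.flexible → dist (φ v) (φ w) = L.length s(v, w))}

/-- The map `φ ↦ (φ (w₁), …, φ (wₖ))`. -/
def eval {n k : ℕ} {V : Type} [Fintype V] (_L : CabledLinkage n V)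
    (w : Fin k → V) (φ : V → EuclideanSpace ℝ (Fin n)) : Fin k → EuclideanSpace ℝ (Fin n) :=
  fun i => φ (w i)

/-- The linkage `L` with input vertices `w` and output vertices `v` is quasifunctional for `f`. -/
def IsQuasifunctional {n k m : ℕ} {V : Type} [Fintype V]
    (L : CabledLinkage n V)
    (w : Fin k → V) (v : Fin m → V)
    (f : (Fin k → EuclideanSpace ℝ (Fin n)) → (Fin m → EuclideanSpace ℝ (Fin n))) : Prop :=
  ∀ φ ∈ L.configSpace, L.eval v φ = f (L.eval w φ)

/-- `L` with inputs `w` and outputs `v` is functional for `f` with restricted domain `U`. -/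
def IsFunctional {n k m : ℕ} {V : Type} [Fintype V]
    (L : CabledLinkage n V)
    (w : Fin k → V) (v : Fin m → V)
    (f : (Fin k → EuclideanSpace ℝ (Fin n)) → (Fin m → EuclideanSpace ℝ (Fin n)))
    (U : Set (Fin k → EuclideanSpace ℝ (Fin n))) : Prop :=
  L.IsQuasifunctional w v f ∧ U ⊆ L.eval w '' L.configSpace ∧
    IsAnalyticallyTrivialCover (L.eval w) L.configSpace U

/-- `L` with inputs `w` and outputs `v` is strongly functional for `f` with restricted
domain `U`. -/
def IsStronglyFunctional {n k m : ℕ} {V : Type} [Fintype V]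
    (L : CabledLinkage n V)
    (w : Fin k → V) (v : Fin m → V)
    (f : (Fin k → EuclideanSpace ℝ (Fin n)) → (Fin m → EuclideanSpace ℝ (Fin n)))
    (U : Set (Fin k → EuclideanSpace ℝ (Fin n))) : Prop :=
  L.IsQuasifunctional w v f ∧ U ⊆ L.eval w '' L.configSpace ∧
    IsAnalyticIso (L.eval w) L.configSpace (L.eval w '' L.configSpace)

end CabledLinkage

/-! Rigid bars can enforce linearity. If all axis-parallel pairs of points in a finite grid keep
their distances and each axis carries three values `0`, `1`, `x₂`, then every realization with the
origin at `0` has the form `c ↦ ∑ cᵢ • uᵢ` with unit vectors `uᵢ` (`grid_linear`). A further bar or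
cable from the origin to a grid point then says that a prescribed linear combination of the `uᵢ` has
norm equal to, or at most, one. Fixing some `uᵢ` as basis vectors makes these combinations affine,
and further bars confine each remaining `uᵢ` to a coordinate plane, where it is a complex number
`ωᵢ` of modulus one. Hence every finite system of such norm conditions on planar unit vectors is the
configuration space of a linkage, with any chosen affine combinations as vertices
(`exists_linkage_of_planar_system`).

It remains to compute polynomials with such systems, locally near a base point. Adjoining an
intersection point of two circles is one new unit vector with one condition (`Realizable.dyad`). The
two intersection points combine to Peaucellier's inversion `Y ↦ 1 / conj Y`. Sums and real multiples
cost nothing, so inversion yields squares, products and conjugates of unit vectors, and finally all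
real polynomials in the coordinates. The system represents monomials, and these rescale
homogeneously, so a small neighbourhood of the origin can be blown up to contain `K`
(`exists_planar_system`).

The system has the desired solutions only near the base point `ω₀`, so its unit vectors must be kept
close to `ω₀`. Cables do this without additional variables, which gives the strongly functional
linkage. Without cables, each vector is held at approximately the right distance from two centres by
two-bar arms. Over `K` every arm has exactly two positions, which give the sheets of a trivial
finite cover. -/

open Filter Topology

/-! ### Rigidity of grids -/

section Grid

variable {E : Type*} [NormedAddCommGroup E] [InnerProductSpace ℝ E]

/-- An isometry from a set of reals containing `0` and `1` is affine. -/
theorem eq_smul_of_norm_eq {a b : E} {x : ℝ} (ha : ‖a‖ = |x|) (hb : ‖b‖ = 1)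
    (hab : ‖a - b‖ = |x - 1|) : a = x • b := by
  have h1 : ‖a - b‖ ^ 2 = ‖a‖ ^ 2 - 2 * inner ℝ a b + ‖b‖ ^ 2 := norm_sub_sq_real a b
  have h2 : ‖a - x • b‖ ^ 2 = ‖a‖ ^ 2 - 2 * inner ℝ a (x • b) + ‖x • b‖ ^ 2 :=
    norm_sub_sq_real a _
  rw [inner_smul_right, norm_smul, Real.norm_eq_abs, hb, ha, mul_one, sq_abs] at h2
  rw [hab, ha, hb, sq_abs, sq_abs] at h1
  have h3 : ‖a - x • b‖ ^ 2 = 0 := by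
    rw [h2]; linear_combination (-x) * h1
  exact sub_eq_zero.1 (norm_eq_zero.1 (pow_eq_zero_iff two_ne_zero |>.1 h3))

/-- An affine path in an inner product space cannot meet a sphere in three points. -/
theorem eq_zero_of_norm_add_smul_eq {p d : E} {x r : ℝ} (hx0 : x ≠ 0) (hx1 : x ≠ 1)
    (h0 : ‖p‖ = r) (h1 : ‖p + d‖ = r) (h2 : ‖p + x • d‖ = r) : d = 0 := by
  have e1 : ‖p + d‖ ^ 2 = ‖p‖ ^ 2 + 2 * inner ℝ p d + ‖d‖ ^ 2 := norm_add_sq_real p d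
  have e2 : ‖p + x • d‖ ^ 2 = ‖p‖ ^ 2 + 2 * inner ℝ p (x • d) + ‖x • d‖ ^ 2 :=
    norm_add_sq_real p _
  rw [inner_smul_right, norm_smul, Real.norm_eq_abs, mul_pow, sq_abs, h2, h0] at e2
  rw [h1, h0] at e1
  have h3 : x * (x - 1) * ‖d‖ ^ 2 = 0 := by linear_combination x * e1 - e2
  have h4 : ‖d‖ ^ 2 = 0 := by
    rcases mul_eq_zero.1 h3 with h | h
    · exact absurd h (mul_ne_zero hx0 (sub_ne_zero.2 hx1))
    · exact h
  exact norm_eq_zero.1 (pow_eq_zero_iff two_ne_zero |>.1 h4)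

variable {I : Type} [Fintype I] [DecidableEq I] {A : Set ℝ}

/-- If all pairs of points of a grid that differ in one coordinate are kept at their
distance, then the grid is realized by a linear map that is isometric on the axes. -/
theorem grid_linear (h0 : (0 : ℝ) ∈ A) (h1 : (1 : ℝ) ∈ A) {x₂ : ℝ} (hx : x₂ ∈ A)
    (hx0 : x₂ ≠ 0) (hx1 : x₂ ≠ 1) (φ : (I → A) → E) (hφ0 : φ (fun _ => ⟨0, h0⟩) = 0)
    (hφ : ∀ c i (x y : A), x ≠ y →
      dist (φ (Function.update c i x)) (φ (Function.update c i y)) = |(x : ℝ) - y|) :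
    ∃ u : I → E, (∀ i, ‖u i‖ = 1) ∧ ∀ c, φ c = ∑ i, (c i : ℝ) • u i := by
  have hd : ∀ c i (x y : A),
      ‖φ (Function.update c i x) - φ (Function.update c i y)‖ = |(x : ℝ) - y| := by
    intro c i x y
    by_cases h : x = y
    · simp [h]
    · rw [← dist_eq_norm]; exact hφ c i x y h
  set a0 : A := ⟨0, h0⟩
  set a1 : A := ⟨1, h1⟩
  let v : I → (I → A) → E := fun i c => φ (Function.update c i a1) - φ (Function.update c i a0)
  have hv1 : ∀ i c, ‖v i c‖ = 1 := by
    intro i c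
    have := hd c i a1 a0
    simpa [a0, a1, v] using this
  have hline : ∀ c i (x : A), φ (Function.update c i x)
      = φ (Function.update c i a0) + (x : ℝ) • v i c := by
    intro c i x
    rw [← eq_smul_of_norm_eq (a := φ (Function.update c i x) - φ (Function.update c i a0))
      (x := x) _ (hv1 i c) _]
    · abel
    · have := hd c i x a0
      simpa [a0] using this
    · have := hd c i x a1
      simpa [a1, v] using this
  -- Two lines in direction `i` through points differing in coordinate `j` have a difference that is
  -- affine in `x` and has the same norm at `0`, `1` and `x₂`, so it is constant. The third value
  -- `x₂` is what excludes a folded parallelogram.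
  have hstep : ∀ c i j (t : A), v i (Function.update c j t) = v i c := by
    intro c i j t
    by_cases hij : j = i
    · subst hij; simp [v]
    have key : ∀ x : A, ‖(φ (Function.update (Function.update c j t) i a0)
        - φ (Function.update c i a0)) + (x : ℝ) • (v i (Function.update c j t) - v i c)‖
        = |(t : ℝ) - c j| := by
      intro x
      have e := hd (Function.update c i x) j t (c j)
      have e3 : Function.update (Function.update c i x) j (c j) = Function.update c i x := by
        conv_rhs => rw [← Function.update_eq_self j (Function.update c i x)]
        rw [Function.update_of_ne hij]
      rw [e3, Function.update_comm (Ne.symm hij), hline (Function.update c j t) i x,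
        hline c i x] at e
      rw [← e]
      congr 1
      rw [smul_sub]
      abel
    have k0 := key a0
    have k1 := key a1
    have k2 := key ⟨x₂, hx⟩
    simp only [a0, a1, zero_smul, add_zero, one_smul] at k0 k1 k2
    exact sub_eq_zero.1 (eq_zero_of_norm_add_smul_eq hx0 hx1 k0 k1 k2)
  refine ⟨fun i => v i (fun _ => a0), fun i => hv1 i _, fun c => ?_⟩
  have hind : ∀ s : Finset I, (∀ i, v i (fun j => if j ∈ s then c j else a0)
      = v i (fun _ => a0)) ∧ φ (fun j => if j ∈ s then c j else a0)
      = ∑ i ∈ s, (c i : ℝ) • v i (fun _ => a0) := by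
    intro s
    induction s using Finset.induction_on with
    | empty => simpa using hφ0
    | insert i s his ih =>
      have hup : (fun j => if j ∈ insert i s then c j else a0)
          = Function.update (fun j => if j ∈ s then c j else a0) i (c i) := by
        funext j
        by_cases hji : j = i
        · subst hji; simp
        · simp [hji]
      have hself : Function.update (fun j => if j ∈ s then c j else a0) i a0
          = (fun j => if j ∈ s then c j else a0) := by
        conv_rhs => rw [← Function.update_eq_self i (fun j => if j ∈ s then c j else a0)]
        simp [his]
      refine ⟨fun l => ?_, ?_⟩
      · rw [hup, hstep]; exact ih.1 l
      · rw [hup, hline, hself, ih.1, ih.2, Finset.sum_insert his, add_comm]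
  have := (hind Finset.univ).2
  simpa using this

end Grid

/-! ### The linkage carried by a grid -/

section GridLinkage

variable {n : ℕ} {I : Type} [Fintype I] [DecidableEq I]

/-- Two grid points differ in exactly one coordinate. -/
def GridAdj {I : Type} {A : Finset ℝ} (c d : I → A) : Prop :=
  ∃ i, c i ≠ d i ∧ ∀ j, j ≠ i → c j = d j

theorem GridAdj.symm {I : Type} {A : Finset ℝ} {c d : I → A} (h : GridAdj c d) :
    GridAdj d c := by
  obtain ⟨i, hi, h⟩ := h
  exact ⟨i, hi.symm, fun j hj => (h j hj).symm⟩

open Classical in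
/-- The length of an edge of the grid linkage. -/
noncomputable def gridLength {I : Type} [Fintype I] {A : Finset ℝ} (c d : I → A) : ℝ :=
  if GridAdj c d then ∑ i, |(c i : ℝ) - d i| else 1

theorem gridLength_comm {I : Type} [Fintype I] {A : Finset ℝ} (c d : I → A) :
    gridLength c d = gridLength d c := by
  unfold gridLength
  by_cases h : GridAdj c d
  · simp only [if_pos h, if_pos h.symm, abs_sub_comm]
  · rw [if_neg h, if_neg fun h' => h h'.symm]

theorem sum_abs_sub_of_forall_ne {I : Type} [Fintype I] {A : Finset ℝ} {c d : I → A} {i : I}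
    (h : ∀ j, j ≠ i → c j = d j) : ∑ j, |(c j : ℝ) - d j| = |(c i : ℝ) - d i| := by
  classical
  rw [Finset.sum_eq_single i]
  · intro j _ hj; simp [h j hj]
  · simp

theorem gridLength_pos {I : Type} [Fintype I] {A : Finset ℝ} (c d : I → A) :
    0 < gridLength c d := by
  unfold gridLength
  split_ifs with h
  · obtain ⟨i, hi, h⟩ := h
    rw [sum_abs_sub_of_forall_ne h]
    exact abs_pos.2 (sub_ne_zero.2 fun h => hi (Subtype.ext h))
  · exact one_pos

/-- The grid linkage: grid points that differ in one coordinate are joined by rigid edges, and the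
points of `R` and of `F` are joined to the origin by rigid and by flexible edges. -/
noncomputable def gridLinkage {A : Finset ℝ} (o : I → A) (ho : ∀ i, (o i : ℝ) = 0)
    (R F : Set (I → A)) (hR : o ∉ R) (hF : o ∉ F) (one : I → I → A) (fix : Set I)
    (pos : I → EuclideanSpace ℝ (Fin n)) : CabledLinkage n (I → A) where
  graph :=
    { Adj := fun c d => GridAdj c d ∨ (c = o ∧ (d ∈ R ∨ d ∈ F)) ∨ (d = o ∧ (c ∈ R ∨ c ∈ F))
      symm := ⟨fun c d h => by
        rcases h with h | h | h
        · exact Or.inl h.symm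
        · exact Or.inr (Or.inr h)
        · exact Or.inr (Or.inl h)⟩
      loopless := ⟨fun c h => by
        rcases h with ⟨i, hi, _⟩ | ⟨rfl, h | h⟩ | ⟨rfl, h | h⟩
        · exact hi rfl
        all_goals first | exact hR h | exact hF h⟩ }
  length := Sym2.lift ⟨gridLength, gridLength_comm⟩
  length_pos := by
    intro e _
    induction e with
    | _ c d => exact gridLength_pos c d
  fixed := {c | c = o ∨ ∃ i ∈ fix, c = one i}
  position := fun c => ∑ i, (c i : ℝ) • pos i
  flexible := {e | ∃ d ∈ F, e = s(o, d)}
  flexible_subset := by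
    rintro e ⟨d, hd, rfl⟩
    exact Or.inr (Or.inl ⟨rfl, Or.inr hd⟩)

/-- By `grid_linear` the grid bars leave only the unit vectors `u` free, and the edge from the
origin to `X` measures the norm of `∑ X i • u i`. The non-adjacency hypotheses guarantee that these
extra edges have the default length `1` and do not collide with grid bars. -/
theorem gridLinkage_configSpace {A : Finset ℝ} (o : I → A) (ho : ∀ i, (o i : ℝ) = 0)
    (R F : Set (I → A)) (hR : o ∉ R) (hF : o ∉ F) (one : I → I → A) (fix : Set I)
    (pos : I → EuclideanSpace ℝ (Fin n))
    (hone : ∀ i j, (one i j : ℝ) = if j = i then 1 else 0) {x₂ : ℝ} (hx : x₂ ∈ A)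
    (h0 : (0 : ℝ) ∈ A) (h1 : (1 : ℝ) ∈ A)
    (hx0 : x₂ ≠ 0) (hx1 : x₂ ≠ 1) (hRF : Disjoint R F)
    (hadjR : ∀ X ∈ R, ¬ GridAdj o X) (hadjF : ∀ X ∈ F, ¬ GridAdj o X) :
    (gridLinkage o ho R F hR hF one fix pos).configSpace = {φ | ∃ u : I → EuclideanSpace ℝ (Fin n),
      (∀ i, ‖u i‖ = 1) ∧ (∀ i ∈ fix, u i = pos i) ∧ (∀ X ∈ R, ‖∑ i, (X i : ℝ) • u i‖ = 1) ∧
      (∀ X ∈ F, ‖∑ i, (X i : ℝ) • u i‖ ≤ 1) ∧ ∀ c, φ c = ∑ i, (c i : ℝ) • u i} := by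
  have hsum1 : ∀ (u : I → EuclideanSpace ℝ (Fin n)) i, ∑ j, (one i j : ℝ) • u j = u i := by
    intro u i
    simp [hone]
  have hsum0 : ∀ (u : I → EuclideanSpace ℝ (Fin n)), ∑ j, (o j : ℝ) • u j = 0 := by
    intro u
    simp [ho]
  have oF : ∀ c d, GridAdj c d → s(c, d) ∉ {e | ∃ d ∈ F, e = s(o, d)} := by
    rintro c d h ⟨d', hd', hcd⟩
    rcases Sym2.eq_iff.1 hcd with ⟨rfl, rfl⟩ | ⟨rfl, rfl⟩
    · exact hadjF _ hd' h
    · exact hadjF _ hd' h.symm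
  ext φ
  constructor
  · rintro ⟨hfix, hflex, hrig⟩
    have hφ0 : φ o = 0 := by
      rw [hfix o (Or.inl rfl)]; exact hsum0 pos
    have ho' : o = fun _ => (⟨0, h0⟩ : A) := funext fun i => Subtype.ext (ho i)
    obtain ⟨u, hu, hφ⟩ := grid_linear (A := (A : Set ℝ)) h0 h1 hx hx0 hx1 φ
      (by rw [← hφ0, ho']) (by
        intro c i x y hxy
        have hadj : GridAdj (Function.update c i x) (Function.update c i y) :=
          ⟨i, by simpa using hxy, fun j hj => by simp [hj]⟩
        have := hrig (Function.update c i x) (Function.update c i y)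
          ⟨Or.inl hadj, oF _ _ hadj⟩
        rw [this]
        change gridLength _ _ = _
        rw [gridLength, if_pos hadj, sum_abs_sub_of_forall_ne (i := i)]
        · simp
        · intro j hj; simp [hj])
    refine ⟨u, hu, fun i hi => ?_, fun X hX => ?_, fun X hX => ?_, hφ⟩
    · have e := hfix (one i) (Or.inr ⟨i, hi, rfl⟩)
      rw [hφ, hsum1] at e
      rw [e]
      exact hsum1 pos i
    · have := hrig o X ⟨Or.inr (Or.inl ⟨rfl, Or.inl hX⟩), by
        rintro ⟨d, hd, he⟩
        rcases Sym2.eq_iff.1 he with ⟨-, rfl⟩ | ⟨rfl, -⟩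
        · exact Set.disjoint_left.1 hRF hX hd
        · exact hF hd⟩
      rw [hφ0, dist_zero_left, hφ] at this
      rw [this]
      change gridLength _ _ = _
      rw [gridLength, if_neg (hadjR X hX)]
    · have := hflex o X ⟨X, hX, rfl⟩
      rw [hφ0, dist_zero_left, hφ] at this
      refine this.trans (le_of_eq ?_)
      change gridLength _ _ = _
      rw [gridLength, if_neg (hadjF X hX)]
  · rintro ⟨u, hu, hfix, hR', hF', hφ⟩
    have hφ0 : φ o = 0 := by rw [hφ, hsum0]
    refine ⟨?_, ?_, ?_⟩
    · rintro c (rfl | ⟨i, hi, rfl⟩)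
      · rw [hφ0]; exact (hsum0 pos).symm
      · rw [hφ, hsum1, hfix i hi]; exact (hsum1 pos i).symm
    · rintro c d ⟨X, hX, he⟩
      rw [he]
      have hlen : (gridLinkage o ho R F hR hF one fix pos).length s(o, X) = 1 := by
        change gridLength _ _ = _
        rw [gridLength, if_neg (hadjF X hX)]
      rw [hlen]
      rcases Sym2.eq_iff.1 he with ⟨rfl, rfl⟩ | ⟨rfl, rfl⟩
      · rw [hφ0, dist_zero_left, hφ]; exact hF' _ hX
      · rw [hφ0, dist_zero_right, hφ]; exact hF' _ hX
    · rintro c d ⟨hadj, hnf⟩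
      change _ = gridLength c d
      rcases hadj with h | h | h
      · rw [gridLength, if_pos h]
        obtain ⟨i, hi, h⟩ := h
        rw [sum_abs_sub_of_forall_ne h, hφ, hφ, dist_eq_norm, ← Finset.sum_sub_distrib,
          Finset.sum_eq_single i]
        · rw [← sub_smul, norm_smul, hu, mul_one, Real.norm_eq_abs]
        · intro j _ hj
          have e : c j = d j := h j hj
          rw [e, sub_self]
        · simp
      · obtain ⟨rfl, h | h⟩ := h
        · rw [gridLength, if_neg (hadjR _ h), hφ0, dist_zero_left, hφ]; exact hR' _ h
        · exact absurd ⟨d, h, rfl⟩ hnf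
      · obtain ⟨rfl, h | h⟩ := h
        · rw [gridLength_comm, gridLength, if_neg (hadjR _ h), hφ0, dist_zero_right, hφ]
          exact hR' _ h
        · exact absurd ⟨c, h, Sym2.eq_swap⟩ hnf

end GridLinkage

/-! ### Planar unit vectors and their linkages -/

section Planar

variable {n : ℕ}

/-- The embedding of `ℂ` as the coordinate plane spanned by the basis vectors `a` and `b`. -/
noncomputable def planeEmb (a b : Fin n) : ℂ →L[ℝ] EuclideanSpace ℝ (Fin n) :=
  Complex.reCLM.smulRight (EuclideanSpace.single a (1 : ℝ)) +
    Complex.imCLM.smulRight (EuclideanSpace.single b (1 : ℝ))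

theorem planeEmb_apply (a b : Fin n) (w : ℂ) : planeEmb a b w =
    w.re • EuclideanSpace.single a (1 : ℝ) + w.im • EuclideanSpace.single b (1 : ℝ) := rfl

theorem planeEmb_apply_left {a b : Fin n} (hab : b ≠ a) (w : ℂ) : planeEmb a b w a = w.re := by
  simp [planeEmb_apply, hab.symm]

theorem planeEmb_apply_right {a b : Fin n} (hab : b ≠ a) (w : ℂ) : planeEmb a b w b = w.im := by
  simp [planeEmb_apply, hab]

theorem planeEmb_apply_of_ne {a b l : Fin n} (ha : l ≠ a) (hb : l ≠ b) (w : ℂ) :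
    planeEmb a b w l = 0 := by
  simp [planeEmb_apply, ha, hb]

theorem norm_planeEmb {a b : Fin n} (hab : b ≠ a) (w : ℂ) : ‖planeEmb a b w‖ = ‖w‖ := by
  have h : ‖planeEmb a b w‖ ^ 2 = ‖w‖ ^ 2 := by
    rw [EuclideanSpace.norm_sq_eq, Complex.sq_norm, Complex.normSq_apply,
      Finset.sum_eq_add a b hab.symm]
    · rw [planeEmb_apply_left hab, planeEmb_apply_right hab, Real.norm_eq_abs, Real.norm_eq_abs,
        sq_abs, sq_abs]
      ring
    · rintro c - ⟨h1, h2⟩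
      simp [planeEmb_apply_of_ne h1 h2]
    · simp
    · simp
  exact (pow_left_inj₀ (norm_nonneg _) (norm_nonneg _) two_ne_zero).1 h

theorem planeEmb_injective {a b : Fin n} (hab : b ≠ a) : Function.Injective (planeEmb a b) := by
  intro z w h
  apply Complex.ext
  · rw [← planeEmb_apply_left hab, h, planeEmb_apply_left hab]
  · rw [← planeEmb_apply_right hab, h, planeEmb_apply_right hab]

theorem eq_planeEmb {a b : Fin n} (hab : b ≠ a) (u : EuclideanSpace ℝ (Fin n))
    (h : ∀ l, l ≠ a → l ≠ b → u l = 0) : planeEmb a b ⟨u a, u b⟩ = u := by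
  ext l
  by_cases ha : l = a
  · subst ha; rw [planeEmb_apply_left hab]
  by_cases hb : l = b
  · subst hb; rw [planeEmb_apply_right hab]
  rw [planeEmb_apply_of_ne ha hb, h l ha hb]

/-- Affine combinations of planar vectors. -/
noncomputable def comb {I : Type} [Fintype I] (a : Fin n) (pl : I → Fin n) (t : I → ℝ)
    (y : EuclideanSpace ℝ (Fin n)) (ω : I → ℂ) : EuclideanSpace ℝ (Fin n) :=
  ∑ i, t i • planeEmb a (pl i) (ω i) + y

/-- For unit `u` one has `‖u - e_l‖ ^ 2 = 2 - 2 * u l`. This turns the vanishing of a coordinate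
into a norm condition of the kind that a bar imposes. -/
theorem apply_eq_zero_iff_norm_sub {u : EuclideanSpace ℝ (Fin n)} (hu : ‖u‖ = 1) (l : Fin n) :
    ‖(√2)⁻¹ • u - (√2)⁻¹ • EuclideanSpace.single l (1 : ℝ)‖ = 1 ↔ u l = 0 := by
  have h : ‖u - EuclideanSpace.single l (1 : ℝ)‖ ^ 2 = 2 - 2 * u l := by
    rw [norm_sub_sq_real, hu, EuclideanSpace.inner_single_right, PiLp.norm_single]
    norm_num
    ring
  have h2 : (0 : ℝ) < √2 := by positivity
  rw [← smul_sub, norm_smul, Real.norm_eq_abs, abs_of_pos (inv_pos.2 h2),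
    inv_mul_eq_one₀ h2.ne', ← pow_left_inj₀ h2.le (norm_nonneg _) two_ne_zero, h,
    Real.sq_sqrt (by norm_num)]
  constructor <;> intro h <;> linarith

theorem not_gridAdj_of_two_ne {I : Type} {A : Finset ℝ} {o X : I → A} {i j : I} (hij : i ≠ j)
    (hi : X i ≠ o i) (hj : X j ≠ o j) : ¬ GridAdj o X := by
  rintro ⟨l, _, h⟩
  by_cases hl : i = l
  · exact hj (h j (by rw [← hl]; exact hij.symm)).symm
  · exact hi (h i hl).symm

theorem sum_smul_single (y : EuclideanSpace ℝ (Fin n)) :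
    ∑ l, y l • EuclideanSpace.single l (1 : ℝ) = y := by
  ext j
  simp [Finset.sum_apply, Pi.single_apply]

/-- A system of planar unit vectors subject to conditions on the norms of affine combinations
is the configuration space of a linkage. -/
theorem exists_linkage_of_planar_system {I B B' O : Type} [Fintype I] [Fintype B] [Fintype B']
    [Fintype O] (a : Fin n) (pl : I → Fin n) (hpl : ∀ i, pl i ≠ a) (con : B → I → ℝ)
    (cst : B → EuclideanSpace ℝ (Fin n)) (con' : B' → I → ℝ)
    (cst' : B' → EuclideanSpace ℝ (Fin n)) (t : O → I → ℝ) (y : O → EuclideanSpace ℝ (Fin n)) :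
    ∃ (V : Type) (_ : Fintype V) (L : CabledLinkage n V) (out : O → V) (unit : I → V)
      (T : V → I → ℝ) (Y : V → EuclideanSpace ℝ (Fin n)),
      (IsEmpty B' → L.IsClassical) ∧ Function.Injective out ∧
      (∀ x ω, comb a pl (T (out x)) (Y (out x)) ω = comb a pl (t x) (y x) ω) ∧
      (∀ i ω, comb a pl (T (unit i)) (Y (unit i)) ω = planeEmb a (pl i) (ω i)) ∧
      L.configSpace = {φ | ∃ ω : I → ℂ, (∀ i, ‖ω i‖ = 1) ∧
        (∀ b, ‖comb a pl (con b) (cst b) ω‖ = 1) ∧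
        (∀ b, ‖comb a pl (con' b) (cst' b) ω‖ ≤ 1) ∧
        φ = fun v => comb a pl (T v) (Y v) ω} := by
  classical
  -- Both `Bool` axes are fixed at the same basis vector and carry opposite coefficients `s` and
  -- `-s`. They cancel in space, but as a tag they separate grid points: tag `1` marks bars, tag `2`
  -- marks cables, and pairwise different tags keep the outputs distinct. A nonzero tag also makes a
  -- point differ from the origin in two coordinates, hence not adjacent to it.
  let cvec : (I → ℝ) → EuclideanSpace ℝ (Fin n) → ℝ → (I ⊕ Fin n ⊕ Bool) → ℝ :=
    fun t y s => Sum.elim t (Sum.elim y (fun b => if b then s else -s))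
  let s : O → ℝ := fun x => ((Fintype.equivFin O x : ℕ) : ℝ)
  have hs : Function.Injective s := fun x x' h => by
    apply (Fintype.equivFin O).injective
    apply Fin.ext
    exact Nat.cast_injective (R := ℝ) h
  let vec : B ⊕ B' ⊕ (I × Fin n) ⊕ O → (I ⊕ Fin n ⊕ Bool) → ℝ :=
    Sum.elim (fun b => cvec (con b) (cst b) 1) <| Sum.elim (fun b => cvec (con' b) (cst' b) 2) <|
    Sum.elim (fun p => cvec (Pi.single p.1 (√2)⁻¹)
      (-((√2)⁻¹ • EuclideanSpace.single p.2 (1 : ℝ))) 1) (fun x => cvec (t x) (y x) (s x))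
  let A : Finset ℝ := {0, 1, 2} ∪ Finset.univ.image (fun p : _ × _ => vec p.1 p.2)
  have h0 : (0 : ℝ) ∈ A := by simp [A]
  have h1 : (1 : ℝ) ∈ A := by simp [A]
  have h2 : (2 : ℝ) ∈ A := by simp [A]
  let gv : B ⊕ B' ⊕ (I × Fin n) ⊕ O → (I ⊕ Fin n ⊕ Bool) → A := fun d i => ⟨vec d i, by
    refine Finset.mem_union_right _ (Finset.mem_image.2 ⟨(d, i), Finset.mem_univ _, rfl⟩)⟩
  let o : (I ⊕ Fin n ⊕ Bool) → A := fun _ => ⟨0, h0⟩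
  let one : (I ⊕ Fin n ⊕ Bool) → (I ⊕ Fin n ⊕ Bool) → A :=
    fun i j => if j = i then ⟨1, h1⟩ else ⟨0, h0⟩
  -- The second family consists of the bars that force `u i` into the plane of `a` and `pl i`.
  let R : Set ((I ⊕ Fin n ⊕ Bool) → A) := {X | (∃ b, X = gv (Sum.inl b)) ∨
    ∃ i l, l ≠ a ∧ l ≠ pl i ∧ X = gv (Sum.inr (Sum.inr (Sum.inl (i, l))))}
  let F : Set ((I ⊕ Fin n ⊕ Bool) → A) := {X | ∃ b, X = gv (Sum.inr (Sum.inl b))}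
  let pos : (I ⊕ Fin n ⊕ Bool) → EuclideanSpace ℝ (Fin n) := Sum.elim (fun _ => 0)
    (Sum.elim (fun l => EuclideanSpace.single l 1) (fun _ => EuclideanSpace.single a 1))
  have hRval : ∀ X ∈ R, ∀ c, ((X (Sum.inr (Sum.inr c)) : A) : ℝ) = if c then 1 else -1 := by
    rintro X (⟨b, rfl⟩ | ⟨i, l, -, -, rfl⟩) c <;> rfl
  have hFval : ∀ X ∈ F, ∀ c, ((X (Sum.inr (Sum.inr c)) : A) : ℝ) = if c then 2 else -2 := by
    rintro X ⟨b, rfl⟩ c; rfl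
  have hadjR : ∀ X ∈ R, ¬ GridAdj o X := by
    intro X hX
    refine not_gridAdj_of_two_ne (i := Sum.inr (Sum.inr true)) (j := Sum.inr (Sum.inr false))
      (by simp) ?_ ?_ <;>
    · intro h
      have := congrArg Subtype.val h
      rw [hRval X hX] at this
      norm_num [o] at this
  have hadjF : ∀ X ∈ F, ¬ GridAdj o X := by
    intro X hX
    refine not_gridAdj_of_two_ne (i := Sum.inr (Sum.inr true)) (j := Sum.inr (Sum.inr false))
      (by simp) ?_ ?_ <;>
    · intro h
      have := congrArg Subtype.val h
      rw [hFval X hX] at this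
      norm_num [o] at this
  have hoR : o ∉ R := by
    intro h
    have := hRval o h true
    norm_num [o] at this
  have hoF : o ∉ F := by
    intro h
    have := hFval o h true
    norm_num [o] at this
  have hRF : Disjoint R F := by
    rw [Set.disjoint_left]
    intro X hX hX'
    have e := hRval X hX true
    rw [hFval X hX' true] at e
    norm_num at e
  let T : ((I ⊕ Fin n ⊕ Bool) → A) → I → ℝ := fun v i => v (Sum.inl i)
  let Y : ((I ⊕ Fin n ⊕ Bool) → A) → EuclideanSpace ℝ (Fin n) := fun v =>
    ∑ l, (v (Sum.inr (Sum.inl l)) : ℝ) • EuclideanSpace.single l (1 : ℝ) +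
      ∑ c, (v (Sum.inr (Sum.inr c)) : ℝ) • EuclideanSpace.single a (1 : ℝ)
  have hsum : ∀ (v : (I ⊕ Fin n ⊕ Bool) → A) (u : (I ⊕ Fin n ⊕ Bool) → EuclideanSpace ℝ (Fin n)),
      (∀ i ∈ Set.range Sum.inr, u i = pos i) →
      ∑ i, (v i : ℝ) • u i = ∑ i, T v i • u (Sum.inl i) + Y v := by
    intro v u hu
    rw [Fintype.sum_sum_type, Fintype.sum_sum_type]
    congr 2
    · exact Finset.sum_congr rfl fun l _ => by rw [hu _ ⟨_, rfl⟩]; rfl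
    · exact Finset.sum_congr rfl fun l _ => by rw [hu _ ⟨_, rfl⟩]; rfl
  have hgv : ∀ d t y s, vec d = cvec t y s → T (gv d) = t ∧ Y (gv d) = y := by
    intro d t y s h
    refine ⟨funext fun i => congrFun h (Sum.inl i), ?_⟩
    have e1 : ∀ l, ((gv d (Sum.inr (Sum.inl l)) : A) : ℝ) = y l := fun l => congrFun h _
    have e2 : ∀ c, ((gv d (Sum.inr (Sum.inr c)) : A) : ℝ) = if c then s else -s :=
      fun c => congrFun h _
    simp only [Y, e1, e2, sum_smul_single]
    simp
  have hcomb : ∀ d t y s, vec d = cvec t y s → ∀ ω, comb a pl (T (gv d)) (Y (gv d)) ω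
      = comb a pl t y ω := by
    intro d t y s h ω
    rw [(hgv d t y s h).1, (hgv d t y s h).2]
  refine ⟨_, inferInstance, gridLinkage o (fun _ => rfl) R F hoR hoF one (Set.range Sum.inr) pos,
    fun x => gv (Sum.inr (Sum.inr (Sum.inr x))), fun i => one (Sum.inl i), T, Y, ?_, ?_, ?_, ?_, ?_⟩
  · intro hB'
    refine Set.eq_empty_of_forall_notMem ?_
    rintro e ⟨d, ⟨b, -⟩, -⟩
    exact hB'.elim b
  · intro x x' h
    apply hs
    exact congrArg Subtype.val (congrFun h (Sum.inr (Sum.inr true)))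
  · exact fun x ω => hcomb _ _ _ (s x) rfl ω
  · intro i ω
    have e1 : T (one (Sum.inl i)) = fun j => if j = i then 1 else 0 := by
      funext j
      by_cases h : j = i <;> simp [T, one, h]
    have e2 : Y (one (Sum.inl i)) = 0 := by simp [Y, one]
    rw [e1, e2]
    simp [comb]
  · rw [gridLinkage_configSpace o (fun _ => rfl) R F hoR hoF one (Set.range Sum.inr) pos
      (fun i j => by by_cases h : j = i <;> simp [one, h]) h2 h0 h1 two_ne_zero (by norm_num)
      hRF hadjR hadjF]
    ext φ
    constructor
    · rintro ⟨u, hu1, hufix, huR, huF, huφ⟩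
      have hpla : ∀ i, planeEmb a (pl i) ⟨u (Sum.inl i) a, u (Sum.inl i) (pl i)⟩
          = u (Sum.inl i) := by
        intro i
        refine eq_planeEmb (hpl i) _ fun l hla hlp => ?_
        have e := huR _ (Or.inr ⟨i, l, hla, hlp, rfl⟩)
        rw [hsum _ _ hufix, (hgv _ _ _ 1 rfl).1, (hgv _ _ _ 1 rfl).2] at e
        rw [← apply_eq_zero_iff_norm_sub (hu1 _) l]
        refine (congrArg norm ?_).trans e
        rw [sub_eq_add_neg]
        congr 1
        simp [Pi.single_apply, ite_smul]
      have hc : ∀ v, ∑ i, (v i : ℝ) • u i = comb a pl (T v) (Y v)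
          (fun i => ⟨u (Sum.inl i) a, u (Sum.inl i) (pl i)⟩) := by
        intro v
        rw [hsum v u hufix, comb]
        simp only [hpla]
      refine ⟨fun i => ⟨u (Sum.inl i) a, u (Sum.inl i) (pl i)⟩, fun i => ?_, fun b => ?_,
        fun b => ?_, ?_⟩
      · rw [← norm_planeEmb (hpl i), hpla, hu1]
      · have := huR _ (Or.inl ⟨b, rfl⟩)
        rwa [hc, hcomb _ _ _ 1 rfl] at this
      · have := huF _ ⟨b, rfl⟩
        rwa [hc, hcomb _ _ _ 2 rfl] at this
      · funext v
        rw [huφ, hc]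
    · rintro ⟨ω, hω, hcon, hcon', rfl⟩
      let u : (I ⊕ Fin n ⊕ Bool) → EuclideanSpace ℝ (Fin n) :=
        Sum.elim (fun i => planeEmb a (pl i) (ω i)) (fun i => pos (Sum.inr i))
      have hufix : ∀ i ∈ Set.range Sum.inr, u i = pos i := by
        rintro _ ⟨i, rfl⟩; rfl
      have hc : ∀ v, ∑ i, (v i : ℝ) • u i = comb a pl (T v) (Y v) ω := fun v => hsum v u hufix
      have hu1 : ∀ i, ‖u (Sum.inl i)‖ = 1 := fun i => (norm_planeEmb (hpl i) _).trans (hω i)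
      refine ⟨u, ?_, hufix, ?_, ?_, fun v => (hc v).symm⟩
      · rintro (i | l | c)
        · exact hu1 i
        · simp [u, pos]
        · simp [u, pos]
      · rintro X (⟨b, rfl⟩ | ⟨i, l, hla, hlp, rfl⟩)
        · rw [hc, hcomb _ _ _ 1 rfl]; exact hcon b
        · rw [hsum _ _ hufix, (hgv _ _ _ 1 rfl).1, (hgv _ _ _ 1 rfl).2]
          have e := (apply_eq_zero_iff_norm_sub (hu1 i) l).2 (planeEmb_apply_of_ne hla hlp _)
          refine (congrArg norm ?_).trans e
          rw [sub_eq_add_neg]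
          congr 1
          simp [Pi.single_apply, ite_smul]
      · rintro X ⟨b, rfl⟩
        rw [hc, hcomb _ _ _ 2 rfl]; exact hcon' b

end Planar

/-! ### Intersections of two circles -/

section Dyad

open Complex

/-- The quantity that is positive when the circles of radii `R` and `r` about `0` and `Y` meet in
two points. -/
noncomputable def dyadDisc (R r : ℝ) (Y : ℂ) : ℝ :=
  R ^ 2 / normSq Y - ((1 + (R ^ 2 - r ^ 2) / normSq Y) / 2) ^ 2

/-- The direction of the point of intersection of the circles of radii `R` and `r` about `0` and
`Y`, on the side given by the sign `s`. -/
noncomputable def dyad (R r s : ℝ) (Y : ℂ) : ℂ :=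
  Y * (((1 + (R ^ 2 - r ^ 2) / normSq Y) / 2 : ℝ) + (s * √(dyadDisc R r Y) : ℝ) * I) / R

theorem norm_eq_iff_normSq {w : ℂ} {r : ℝ} (hr : 0 ≤ r) : ‖w‖ = r ↔ normSq w = r ^ 2 := by
  rw [Complex.normSq_eq_norm_sq, pow_left_inj₀ (norm_nonneg _) hr two_ne_zero]

theorem normSq_real_add_mul_I (x y : ℝ) : normSq ((x : ℂ) + (y : ℂ) * I) = x ^ 2 + y ^ 2 := by
  rw [Complex.normSq_add_mul_I]

theorem norm_dyad {R r s : ℝ} {Y : ℂ} (hY : Y ≠ 0) (hR : 0 < R) (hs : s = 1 ∨ s = -1)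
    (hd : 0 ≤ dyadDisc R r Y) : ‖dyad R r s Y‖ = 1 := by
  have hy : normSq Y ≠ 0 := by rwa [Ne, Complex.normSq_eq_zero]
  have hs2 : s ^ 2 = 1 := by rcases hs with rfl | rfl <;> norm_num
  rw [norm_eq_iff_normSq zero_le_one, dyad, map_div₀, map_mul, normSq_real_add_mul_I, mul_pow, hs2,
    Real.sq_sqrt hd, dyadDisc, Complex.normSq_ofReal]
  field_simp
  ring

theorem norm_mul_dyad_sub {R r s : ℝ} {Y : ℂ} (hY : Y ≠ 0) (hR : 0 < R) (hr : 0 < r)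
    (hs : s = 1 ∨ s = -1) (hd : 0 ≤ dyadDisc R r Y) : ‖R * dyad R r s Y - Y‖ = r := by
  have hy : normSq Y ≠ 0 := by rwa [Ne, Complex.normSq_eq_zero]
  have hs2 : s ^ 2 = 1 := by rcases hs with rfl | rfl <;> norm_num
  have hR' : (R : ℂ) ≠ 0 := by exact_mod_cast hR.ne'
  have e : R * dyad R r s Y - Y = Y * (((1 + (R ^ 2 - r ^ 2) / normSq Y) / 2 - 1 : ℝ) +
      (s * √(dyadDisc R r Y) : ℝ) * I) := by
    rw [dyad]
    push_cast
    field_simp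
    ring
  rw [norm_eq_iff_normSq hr.le, e, map_mul, normSq_real_add_mul_I, mul_pow, hs2,
    Real.sq_sqrt hd, dyadDisc]
  field_simp
  ring

/-- Put `v = R * w / Y`. The two conditions prescribe `|v| ^ 2` and `|v - 1| ^ 2`, hence the real
part of `v` and the square of its imaginary part. -/
theorem eq_dyad_or_eq_dyad {R r : ℝ} {Y w : ℂ} (hY : Y ≠ 0) (hR : 0 < R) (hr : 0 < r)
    (hw : ‖w‖ = 1) (hwY : ‖R * w - Y‖ = r) : w = dyad R r 1 Y ∨ w = dyad R r (-1) Y := by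
  have hy : normSq Y ≠ 0 := by rwa [Ne, Complex.normSq_eq_zero]
  have hR' : (R : ℂ) ≠ 0 := by exact_mod_cast hR.ne'
  obtain ⟨v, rfl⟩ : ∃ v, w = Y * v / R := ⟨R * w / Y, by field_simp⟩
  have e : R * (Y * v / R) - Y = Y * (v - 1) := by field_simp
  rw [norm_eq_iff_normSq zero_le_one, map_div₀, map_mul, Complex.normSq_ofReal] at hw
  rw [e, norm_eq_iff_normSq hr.le, map_mul] at hwY
  have hw' : normSq v = R ^ 2 / normSq Y := by
    field_simp at hw ⊢
    linarith
  have hv' : normSq (v - 1) = r ^ 2 / normSq Y := by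
    field_simp
    linarith
  rw [Complex.normSq_apply] at hw' hv'
  simp only [sub_re, sub_im, one_re, one_im, sub_zero] at hv'
  have hre : v.re = (1 + (R ^ 2 - r ^ 2) / normSq Y) / 2 := by
    rw [sub_div]
    linarith
  have him : v.im ^ 2 = dyadDisc R r Y := by
    rw [dyadDisc, ← hre]
    linarith
  have hv : v = (v.re : ℂ) + (v.im : ℂ) * I := (Complex.re_add_im v).symm
  rcases le_total 0 v.im with h | h
  · left
    rw [dyad, ← him, Real.sqrt_sq h, one_mul, ← hre, ← hv]
  · right
    rw [dyad, ← him, Real.sqrt_sq_eq_abs, abs_of_nonpos h, ← hre]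
    congr 2
    rw [neg_one_mul, neg_neg, ← hv]

theorem dyad_ne_dyad {R r s : ℝ} {Y : ℂ} (hY : Y ≠ 0) (hR : 0 < R) (hs : s = 1 ∨ s = -1)
    (hd : 0 < dyadDisc R r Y) : dyad R r s Y ≠ dyad R r (-s) Y := by
  have hR' : (R : ℂ) ≠ 0 := by exact_mod_cast hR.ne'
  intro h
  rw [dyad, dyad, div_left_inj' hR', mul_right_inj' hY, add_right_inj,
    mul_left_inj' Complex.I_ne_zero, Complex.ofReal_inj, mul_left_inj' (Real.sqrt_pos.2 hd).ne'] at h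
  rcases hs with rfl | rfl <;> norm_num at h

/-- Peaucellier's inversor: the fourth vertex of the rhombus on `Y` and the two intersection points.
The square roots cancel in the sum, leaving `(R ^ 2 - r ^ 2) * Y / |Y| ^ 2`. -/
theorem dyad_add_dyad_sub {R r : ℝ} {Y : ℂ} (hY : Y ≠ 0) (hR : 0 < R) :
    R * dyad R r 1 Y + R * dyad R r (-1) Y - Y
      = ((R ^ 2 - r ^ 2 : ℝ) : ℂ) * (starRingEnd ℂ Y)⁻¹ := by
  have hR' : (R : ℂ) ≠ 0 := by exact_mod_cast hR.ne'
  have hY' : starRingEnd ℂ Y ≠ 0 := by simpa using hY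
  have hn : ((normSq Y : ℝ) : ℂ) = Y * starRingEnd ℂ Y := Complex.normSq_eq_conj_mul_self.trans
    (mul_comm _ _)
  rw [dyad, dyad]
  push_cast
  rw [hn]
  field_simp
  ring

theorem analyticAt_normSq (Y : ℂ) : AnalyticAt ℝ (fun Y : ℂ => normSq Y) Y := by
  have : (fun Y : ℂ => normSq Y) = fun Y => reCLM Y * reCLM Y + imCLM Y * imCLM Y := by
    funext Y; exact Complex.normSq_apply Y
  rw [this]
  exact ((reCLM.analyticAt Y).mul (reCLM.analyticAt Y)).add
    ((imCLM.analyticAt Y).mul (imCLM.analyticAt Y))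

theorem analyticAt_sqrt {x : ℝ} (hx : 0 < x) : AnalyticAt ℝ Real.sqrt x :=
  (Real.contDiffAt_sqrt (n := ⊤) hx.ne').analyticAt

theorem analyticAt_dyadDisc (R r : ℝ) {Y : ℂ} (hY : Y ≠ 0) : AnalyticAt ℝ (dyadDisc R r) Y := by
  have hy : normSq Y ≠ 0 := by rwa [Ne, Complex.normSq_eq_zero]
  exact (analyticAt_const.div (analyticAt_normSq Y) hy).sub
    (((analyticAt_const.add (analyticAt_const.div (analyticAt_normSq Y) hy)).div
      analyticAt_const two_ne_zero).pow 2)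

theorem analyticAt_ofReal_comp {E : Type*} [NormedAddCommGroup E] [NormedSpace ℝ E] {f : E → ℝ}
    {x : E} (hf : AnalyticAt ℝ f x) : AnalyticAt ℝ (fun x => (f x : ℂ)) x :=
  (ofRealCLM.analyticAt _).comp hf

theorem analyticAt_dyad {R r : ℝ} (s : ℝ) {Y : ℂ} (hY : Y ≠ 0)
    (hd : 0 < dyadDisc R r Y) : AnalyticAt ℝ (dyad R r s) Y := by
  have hy : normSq Y ≠ 0 := by rwa [Ne, Complex.normSq_eq_zero]
  have h1 : AnalyticAt ℝ (fun Y : ℂ => (1 + (R ^ 2 - r ^ 2) / normSq Y) / 2) Y :=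
    (analyticAt_const.add (analyticAt_const.div (analyticAt_normSq Y) hy)).div
      analyticAt_const two_ne_zero
  have h2 : AnalyticAt ℝ (fun Y : ℂ => s * √(dyadDisc R r Y)) Y :=
    analyticAt_const.mul ((analyticAt_sqrt hd).comp (analyticAt_dyadDisc R r hY))
  have : dyad R r s = fun Y => Y * (((1 + (R ^ 2 - r ^ 2) / normSq Y) / 2 : ℝ) +
      (s * √(dyadDisc R r Y) : ℝ) * I) * (R : ℂ)⁻¹ := by
    funext Y
    rw [dyad, div_eq_mul_inv]
  rw [this]
  exact (analyticAt_id.mul ((analyticAt_ofReal_comp h1).add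
    ((analyticAt_ofReal_comp h2).mul analyticAt_const))).mul analyticAt_const

end Dyad

/-! ### Local systems and the germs they represent -/

section LocalSystem

variable {n k : ℕ} {a : Fin n}

theorem analyticAt_comb {I : Type} [Fintype I] (a : Fin n) (pl : I → Fin n) (t : I → ℝ)
    (y : EuclideanSpace ℝ (Fin n)) (ω : I → ℂ) : AnalyticAt ℝ (comb a pl t y) ω := by
  let L : (I → ℂ) →L[ℝ] EuclideanSpace ℝ (Fin n) :=
    ∑ i, t i • (planeEmb a (pl i)).comp (ContinuousLinearMap.proj i)
  have : comb a pl t y = fun ω => L ω + y := by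
    funext ω
    simp [comb, L]
  rw [this]
  exact (L.analyticAt ω).add analyticAt_const

theorem comb_add {I : Type} [Fintype I] (pl : I → Fin n) (t t' : I → ℝ)
    (y y' : EuclideanSpace ℝ (Fin n)) (ω : I → ℂ) :
    comb a pl (t + t') (y + y') ω = comb a pl t y ω + comb a pl t' y' ω := by
  simp only [comb, Pi.add_apply, add_smul, Finset.sum_add_distrib]
  abel

theorem comb_smul {I : Type} [Fintype I] (pl : I → Fin n) (c : ℝ) (t : I → ℝ)
    (y : EuclideanSpace ℝ (Fin n)) (ω : I → ℂ) :
    comb a pl (c • t) (c • y) ω = c • comb a pl t y ω := by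
  simp only [comb, Pi.smul_apply, smul_assoc, smul_add, Finset.smul_sum]

/-- Coefficients on `Option I` that extend given coefficients on `I`. -/
def optionElim {I : Type} {α : Type*} (x : α) (f : I → α) : Option I → α
  | none => x
  | some i => f i

theorem comb_optionElim {I : Type} [Fintype I] (pl : I → Fin n) (j : Fin n) (τ : ℝ) (t : I → ℝ)
    (y : EuclideanSpace ℝ (Fin n)) (ω : Option I → ℂ) :
    comb a (optionElim j pl) (optionElim τ t) y ω
      = τ • planeEmb a j (ω none) + comb a pl t y (ω ∘ some) := by
  simp only [comb, Fintype.sum_option, optionElim, Function.comp_apply, add_assoc]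

/-- A system of planar unit vectors subject to conditions on the norms of affine combinations,
whose solutions near a base point are parametrized by the points near the origin of `(ℝⁿ)ᵏ`. -/
structure LocalSystem (n k : ℕ) (a : Fin n) where
  I : Type
  B : Type
  [fintypeI : Fintype I]
  [fintypeB : Fintype B]
  pl : I → Fin n
  pl_ne : ∀ i, pl i ≠ a
  con : B → I → ℝ
  cst : B → EuclideanSpace ℝ (Fin n)
  g : (Fin k → EuclideanSpace ℝ (Fin n)) → I → ℂ
  Q : (I → ℂ) → (Fin k → EuclideanSpace ℝ (Fin n))
  analytic : AnalyticAt ℝ g 0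
  continuous_Q : Continuous Q
  Q_g : Q (g 0) = 0
  norm_g : ∀ᶠ z in 𝓝 0, ∀ i, ‖g z i‖ = 1
  con_g : ∀ᶠ z in 𝓝 0, ∀ b, ‖comb a pl (con b) (cst b) (g z)‖ = 1
  eq_g : ∀ᶠ ω in 𝓝 (g 0), (∀ i, ‖ω i‖ = 1) →
    (∀ b, ‖comb a pl (con b) (cst b) ω‖ = 1) → ω = g (Q ω)

attribute [instance] LocalSystem.fintypeI LocalSystem.fintypeB

/-- A germ is represented if it is an affine combination of the vectors of the system. -/
def LocalSystem.Represents (S : LocalSystem n k a)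
    (h : (Fin k → EuclideanSpace ℝ (Fin n)) → EuclideanSpace ℝ (Fin n)) : Prop :=
  ∃ t y, ∀ᶠ z in 𝓝 0, comb a S.pl t y (S.g z) = h z

/-- Some local system represents all germs of `H`. -/
def Realizable (a : Fin n)
    (H : Set ((Fin k → EuclideanSpace ℝ (Fin n)) → EuclideanSpace ℝ (Fin n))) : Prop :=
  ∃ S : LocalSystem n k a, ∀ h ∈ H, S.Represents h

theorem Realizable.mono {H H' : Set ((Fin k → EuclideanSpace ℝ (Fin n)) →
    EuclideanSpace ℝ (Fin n))} (h : Realizable a H) (hH : H' ⊆ H) : Realizable a H' := by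
  obtain ⟨S, hS⟩ := h
  exact ⟨S, fun x hx => hS x (hH hx)⟩

theorem LocalSystem.Represents.analyticAt {S : LocalSystem n k a} {j : Fin n} (hj : j ≠ a)
    {Y : (Fin k → EuclideanSpace ℝ (Fin n)) → ℂ}
    (h : S.Represents fun z => planeEmb a j (Y z)) : AnalyticAt ℝ Y 0 := by
  obtain ⟨t, y, h⟩ := h
  have h1 : AnalyticAt ℝ (fun z => planeEmb a j (Y z)) 0 :=
    ((analyticAt_comb a S.pl t y (S.g 0)).comp S.analytic).congr h
  have h2 : ∀ l : Fin n, AnalyticAt ℝ (fun z => planeEmb a j (Y z) l) 0 := fun l =>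
    ((EuclideanSpace.proj (𝕜 := ℝ) l).analyticAt _).comp h1
  have h3 : Y = fun z => ((planeEmb a j (Y z) a : ℝ) : ℂ) +
      ((planeEmb a j (Y z) j : ℝ) : ℂ) * Complex.I := by
    funext z
    rw [planeEmb_apply_left hj, planeEmb_apply_right hj, Complex.re_add_im]
  rw [h3]
  exact (analyticAt_ofReal_comp (h2 a)).add ((analyticAt_ofReal_comp (h2 j)).mul analyticAt_const)

/-- All conditions of a system have right-hand side `1`, so the condition of radius `r` is divided
by `r`. -/
theorem comb_dyad {I : Type} [Fintype I] (pl : I → Fin n) {j : Fin n} (hj : j ≠ a) {r R : ℝ}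
    (hr : 0 < r) (t : I → ℝ) (y : EuclideanSpace ℝ (Fin n)) (ω : Option I → ℂ) {Y : ℂ}
    (h : comb a pl t y (ω ∘ some) = planeEmb a j Y) :
    ‖comb a (optionElim j pl) (optionElim (R / r) (-r⁻¹ • t)) (-r⁻¹ • y) ω‖ = 1 ↔
      ‖R * ω none - Y‖ = r := by
  rw [comb_optionElim, comb_smul, h]
  have : (R / r) • planeEmb a j (ω none) + -r⁻¹ • planeEmb a j Y
      = r⁻¹ • planeEmb a j (R * ω none - Y) := by
    have e : (R : ℂ) * ω none = R • ω none := by simp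
    rw [e, map_sub, map_smul, smul_sub, smul_smul, neg_smul, sub_eq_add_neg, div_eq_inv_mul]
  rw [this, norm_smul, norm_planeEmb hj, norm_inv, Real.norm_eq_abs, abs_of_pos hr,
    inv_mul_eq_one₀ hr.ne', eq_comm]

/-- Adjoining the intersection point of two circles. -/
theorem Realizable.dyad {H : Set ((Fin k → EuclideanSpace ℝ (Fin n)) → EuclideanSpace ℝ (Fin n))}
    (hH : Realizable a H) {j : Fin n} (hj : j ≠ a)
    {Y : (Fin k → EuclideanSpace ℝ (Fin n)) → ℂ}
    (hY : (fun z => planeEmb a j (Y z)) ∈ H) (hY0 : Y 0 ≠ 0) {R r s : ℝ} (hR : 0 < R)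
    (hr : 0 < r) (hs : s = 1 ∨ s = -1) (hd : 0 < dyadDisc R r (Y 0)) :
    Realizable a (insert (fun z => planeEmb a j (dyad R r s (Y z))) H) := by
  obtain ⟨S, hS⟩ := hH
  have hYan : AnalyticAt ℝ Y 0 := (hS _ hY).analyticAt hj
  obtain ⟨t, y, hty⟩ := hS _ hY
  have hYne : ∀ᶠ z in 𝓝 0, Y z ≠ 0 := hYan.continuousAt.eventually_ne hY0
  have hdpos : ∀ᶠ z in 𝓝 0, 0 < dyadDisc R r (Y z) :=
    ((analyticAt_dyadDisc R r hY0).continuousAt.comp hYan.continuousAt).eventually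
      (lt_mem_nhds hd)
  have hdan : ∀ s, AnalyticAt ℝ (fun z => _root_.dyad R r s (Y z)) 0 := fun s =>
    (analyticAt_dyad s hY0 hd).comp hYan
  let g' : (Fin k → EuclideanSpace ℝ (Fin n)) → Option S.I → ℂ := fun z =>
    optionElim (_root_.dyad R r s (Y z)) (S.g z)
  have hg'some : ∀ z, g' z ∘ some = S.g z := fun z => rfl
  let pl' : Option S.I → Fin n := optionElim j S.pl
  let con' : Option S.B → Option S.I → ℝ :=
    optionElim (optionElim (R / r) (-r⁻¹ • t)) (fun b => optionElim 0 (S.con b))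
  let cst' : Option S.B → EuclideanSpace ℝ (Fin n) := optionElim (-r⁻¹ • y) S.cst
  have hsome : ∀ t y ω, comb a pl' (optionElim 0 t) y ω = comb a S.pl t y (ω ∘ some) := by
    intro t y ω
    rw [comb_optionElim, zero_smul, zero_add]
  have hrestr : Tendsto (fun ω : Option S.I → ℂ => ω ∘ some) (𝓝 (g' 0)) (𝓝 (S.g 0)) := by
    have : Continuous fun ω : Option S.I → ℂ => ω ∘ some := by fun_prop
    exact this.tendsto (g' 0)
  have hQ' : Tendsto (fun ω : Option S.I → ℂ => S.Q (ω ∘ some)) (𝓝 (g' 0)) (𝓝 0) := by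
    have := S.continuous_Q.tendsto (S.g 0)
    rw [S.Q_g] at this
    exact this.comp hrestr
  refine ⟨{ I := Option S.I, B := Option S.B, pl := pl', con := con', cst := cst', g := g'
            Q := fun ω => S.Q (ω ∘ some)
            pl_ne := ?_, analytic := ?_, continuous_Q := ?_, Q_g := S.Q_g, norm_g := ?_
            con_g := ?_, eq_g := ?_ }, ?_⟩
  · rintro (_ | i)
    · exact hj
    · exact S.pl_ne i
  · refine AnalyticAt.pi ?_
    rintro (_ | i)
    · exact hdan s
    · exact ((ContinuousLinearMap.proj (R := ℝ) (φ := fun _ : S.I => ℂ) i).analyticAt _).comp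
        S.analytic
  · exact S.continuous_Q.comp (by fun_prop)
  · filter_upwards [S.norm_g, hYne, hdpos] with z hz h1 h2
    rintro (_ | i)
    · exact norm_dyad h1 hR hs h2.le
    · exact hz i
  · filter_upwards [S.con_g, hYne, hdpos, hty] with z hz h1 h2 h3
    rintro (_ | b)
    · exact (comb_dyad S.pl hj hr t y (g' z) h3).2 (norm_mul_dyad_sub h1 hR hr hs h2.le)
    · change ‖comb a pl' (optionElim 0 (S.con b)) (S.cst b) (g' z)‖ = 1
      rw [hsome]; exact hz b
  · have hother : ∀ᶠ ω : Option S.I → ℂ in 𝓝 (g' 0),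
        ω none ≠ _root_.dyad R r (-s) (Y (S.Q (ω ∘ some))) := by
      have l1 : Tendsto (fun ω : Option S.I → ℂ => ω none) (𝓝 (g' 0))
          (𝓝 (_root_.dyad R r s (Y 0))) := (continuous_apply none).tendsto (g' 0)
      have l2 : Tendsto (fun ω : Option S.I → ℂ => _root_.dyad R r (-s) (Y (S.Q (ω ∘ some))))
          (𝓝 (g' 0)) (𝓝 (_root_.dyad R r (-s) (Y 0))) :=
        (hdan (-s)).continuousAt.tendsto.comp hQ'
      filter_upwards [(l1.sub l2).eventually_ne (sub_ne_zero.2 (dyad_ne_dyad hY0 hR hs hd))]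
        with ω hω using sub_ne_zero.1 hω
    filter_upwards [hrestr.eventually S.eq_g, hother, hQ'.eventually hYne, hQ'.eventually hty]
      with ω h1 h2 h3 h4 hω hcon
    have e : ω ∘ some = S.g (S.Q (ω ∘ some)) := by
      refine h1 (fun i => hω (some i)) fun b => ?_
      rw [← hsome]; exact hcon (some b)
    have e2 : ‖R * ω none - Y (S.Q (ω ∘ some))‖ = r := by
      refine (comb_dyad S.pl hj hr t y ω ?_).1 (hcon none)
      rw [← h4, ← e]
    have e3 : ω none = _root_.dyad R r s (Y (S.Q (ω ∘ some))) := by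
      rcases hs with rfl | rfl <;>
      rcases eq_dyad_or_eq_dyad h3 hR hr (hω none) e2 with h | h
      · exact h
      · exact absurd h h2
      · rw [neg_neg] at h2
        exact absurd h h2
      · exact h
    funext i
    rcases i with _ | i
    · exact e3
    · exact congrFun e i
  · rintro h (rfl | hh)
    · refine ⟨optionElim 1 0, 0, Eventually.of_forall fun z => ?_⟩
      rw [comb_optionElim, one_smul]
      simp [comb, g', optionElim]
    · obtain ⟨t, y, h⟩ := hS h hh
      refine ⟨optionElim 0 t, y, ?_⟩
      filter_upwards [h] with z hz
      exact (hsome t y (g' z)).trans hz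

/-- The germs of the vectors of the initial system. -/
def startGerms (k : ℕ) (a b : Fin n) :
    Set ((Fin k → EuclideanSpace ℝ (Fin n)) → EuclideanSpace ℝ (Fin n)) :=
  {h | ∃ l j, h = fun z => planeEmb a (if j = a then b else j) ⟨√(1 - z l j ^ 2), z l j⟩}

/-- Each real coordinate of `z` is the imaginary part of its own unit vector near `1`. The real part
is then the positive square root, so no conditions are needed. The coordinate `a` has to borrow the
plane of `b`, because the second axis of a plane must differ from `a`. -/
theorem realizable_startGerms {b : Fin n} (hb : b ≠ a) : Realizable a (startGerms k a b) := by
  have hsmall : ∀ᶠ z : Fin k → EuclideanSpace ℝ (Fin n) in 𝓝 0, ∀ p : Fin k × Fin n,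
      0 < 1 - z p.1 p.2 ^ 2 := by
    rw [eventually_all]
    intro p
    have hc : Continuous fun z : Fin k → EuclideanSpace ℝ (Fin n) => 1 - z p.1 p.2 ^ 2 := by
      fun_prop
    exact hc.continuousAt.eventually (lt_mem_nhds (by simp))
  have hcoord : ∀ (p : Fin k × Fin n) (z : Fin k → EuclideanSpace ℝ (Fin n)),
      AnalyticAt ℝ (fun z : Fin k → EuclideanSpace ℝ (Fin n) => z p.1 p.2) z := fun p z =>
    ((EuclideanSpace.proj (𝕜 := ℝ) p.2).comp (ContinuousLinearMap.proj (R := ℝ)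
      (φ := fun _ : Fin k => EuclideanSpace ℝ (Fin n)) p.1)).analyticAt z
  refine ⟨{ I := Fin k × Fin n, B := Empty, pl := fun p => if p.2 = a then b else p.2
            con := Empty.elim, cst := Empty.elim
            g := fun z p => ⟨√(1 - z p.1 p.2 ^ 2), z p.1 p.2⟩
            Q := fun ω l => WithLp.toLp 2 fun j => (ω (l, j)).im
            pl_ne := ?_, analytic := ?_, continuous_Q := ?_, Q_g := ?_, norm_g := ?_
            con_g := Eventually.of_forall fun z b => b.elim, eq_g := ?_ }, ?_⟩
  · intro p
    split_ifs with h
    · exact hb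
    · exact h
  · refine AnalyticAt.pi fun p => ?_
    have e : (fun z : Fin k → EuclideanSpace ℝ (Fin n) =>
        (⟨√(1 - z p.1 p.2 ^ 2), z p.1 p.2⟩ : ℂ)) = fun z => ((√(1 - z p.1 p.2 ^ 2) : ℝ) : ℂ) +
          ((z p.1 p.2 : ℝ) : ℂ) * Complex.I := by
      funext z
      exact Complex.mk_eq_add_mul_I _ _
    rw [e]
    refine (analyticAt_ofReal_comp ?_).add
      ((analyticAt_ofReal_comp (hcoord p 0)).mul analyticAt_const)
    have h1 : AnalyticAt ℝ (fun z : Fin k → EuclideanSpace ℝ (Fin n) => 1 - z p.1 p.2 ^ 2) 0 :=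
      analyticAt_const.sub ((hcoord p 0).pow 2)
    exact (analyticAt_sqrt (by simp)).comp h1
  · fun_prop
  · funext l
    ext j
    simp
  · filter_upwards [hsmall] with z hz p
    rw [norm_eq_iff_normSq zero_le_one, Complex.normSq_mk, Real.mul_self_sqrt (hz p).le]
    ring
  · have hpos : ∀ᶠ ω : Fin k × Fin n → ℂ in
        𝓝 (fun p => (⟨√(1 - (0 : Fin k → EuclideanSpace ℝ (Fin n)) p.1 p.2 ^ 2), 0⟩ : ℂ)),
        ∀ p, 0 < (ω p).re := by
      rw [eventually_all]
      intro p
      have hc : Continuous fun ω : Fin k × Fin n → ℂ => (ω p).re := by fun_prop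
      exact hc.continuousAt.eventually (lt_mem_nhds (by simp))
    filter_upwards [hpos] with ω hω hnorm _
    funext p
    have e := hnorm p
    rw [norm_eq_iff_normSq zero_le_one, Complex.normSq_apply] at e
    apply Complex.ext
    · change (ω p).re = √(1 - (ω p).im ^ 2)
      rw [eq_comm, Real.sqrt_eq_iff_mul_self_eq_of_pos (hω p)]
      linarith
    · rfl
  · rintro _ ⟨l, j, rfl⟩
    refine ⟨Pi.single (l, j) 1, 0, Eventually.of_forall fun z => ?_⟩
    simp [comb, Pi.single_apply, ite_smul]

end LocalSystem

/-! ### Arithmetic of germs: inversion, products, polynomials -/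

section Extendable

variable {n k : ℕ} {a b : Fin n}

/-- A germ is extendable if it can be adjoined to every realizable set of germs that contains
the initial germs. -/
def Extendable (a b : Fin n)
    (h : (Fin k → EuclideanSpace ℝ (Fin n)) → EuclideanSpace ℝ (Fin n)) : Prop :=
  ∀ H, startGerms k a b ⊆ H → Realizable a H → Realizable a (insert h H)

/-- Adjoin `h₁` and then `h₂`. The resulting system represents both, hence also `h`. Affine
operations thus need no new vectors. -/
theorem Extendable.of_represents
    {h : (Fin k → EuclideanSpace ℝ (Fin n)) → EuclideanSpace ℝ (Fin n)}
    {h₁ h₂ : (Fin k → EuclideanSpace ℝ (Fin n)) → EuclideanSpace ℝ (Fin n)}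
    (H₁ : Extendable a b h₁) (H₂ : Extendable a b h₂)
    (hh : ∀ S : LocalSystem n k a, S.Represents h₁ → S.Represents h₂ → S.Represents h) :
    Extendable a b h := by
  intro H hH hr
  obtain ⟨S, hS⟩ := H₂ _ (hH.trans (Set.subset_insert _ _)) (H₁ H hH hr)
  refine ⟨S, ?_⟩
  rintro x (rfl | hx)
  · exact hh S (hS _ (Or.inr (Or.inl rfl))) (hS _ (Or.inl rfl))
  · exact hS x (Or.inr (Or.inr hx))

theorem Extendable.congr {h h' : (Fin k → EuclideanSpace ℝ (Fin n)) → EuclideanSpace ℝ (Fin n)}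
    (H : Extendable a b h) (e : ∀ᶠ z in 𝓝 0, h z = h' z) : Extendable a b h' := by
  refine H.of_represents H fun S ⟨t, y, hS⟩ _ => ⟨t, y, ?_⟩
  filter_upwards [hS, e] with z h1 h2
  rw [h1, h2]

theorem Extendable.add {h h' : (Fin k → EuclideanSpace ℝ (Fin n)) → EuclideanSpace ℝ (Fin n)}
    (H : Extendable a b h) (H' : Extendable a b h') : Extendable a b fun z => h z + h' z := by
  refine H.of_represents H' fun S ⟨t, y, hS⟩ ⟨t', y', hS'⟩ => ⟨t + t', y + y', ?_⟩
  filter_upwards [hS, hS'] with z h1 h2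
  rw [comb_add, h1, h2]

theorem Extendable.smul {h : (Fin k → EuclideanSpace ℝ (Fin n)) → EuclideanSpace ℝ (Fin n)}
    (c : ℝ) (H : Extendable a b h) : Extendable a b fun z => c • h z := by
  refine H.of_represents H fun S ⟨t, y, hS⟩ _ => ⟨c • t, c • y, ?_⟩
  filter_upwards [hS] with z h1
  rw [comb_smul, h1]

theorem extendable_const (c : EuclideanSpace ℝ (Fin n)) :
    Extendable a b (fun _ : Fin k → EuclideanSpace ℝ (Fin n) => c) := by
  rintro H - ⟨S, hS⟩
  refine ⟨S, ?_⟩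
  rintro x (rfl | hx)
  · exact ⟨0, c, Eventually.of_forall fun z => by simp [comb]⟩
  · exact hS x hx

/-- A complex valued germ is extendable in the coordinate plane `j` if the corresponding planar
germ is extendable. -/
def PlaneExtendable (a b j : Fin n) (Y : (Fin k → EuclideanSpace ℝ (Fin n)) → ℂ) : Prop :=
  Extendable a b fun z => planeEmb a j (Y z)

variable {j : Fin n} {Y Y' : (Fin k → EuclideanSpace ℝ (Fin n)) → ℂ}

theorem PlaneExtendable.congr (H : PlaneExtendable a b j Y) (e : ∀ᶠ z in 𝓝 0, Y z = Y' z) :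
    PlaneExtendable a b j Y' :=
  Extendable.congr H (e.mono fun z hz => by rw [hz])

theorem PlaneExtendable.add (H : PlaneExtendable a b j Y) (H' : PlaneExtendable a b j Y') :
    PlaneExtendable a b j fun z => Y z + Y' z := by
  simpa only [PlaneExtendable, map_add] using Extendable.add H H'

theorem PlaneExtendable.real_mul (c : ℝ) (H : PlaneExtendable a b j Y) :
    PlaneExtendable a b j fun z => (c : ℂ) * Y z := by
  have := Extendable.smul c H
  simpa only [PlaneExtendable, ← map_smul, Complex.real_smul] using this

theorem PlaneExtendable.sub (H : PlaneExtendable a b j Y) (H' : PlaneExtendable a b j Y') :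
    PlaneExtendable a b j fun z => Y z - Y' z :=
  (H.add (H'.real_mul (-1))).congr (Eventually.of_forall fun z => by push_cast; ring)

theorem planeExtendable_const (c : ℂ) :
    PlaneExtendable a b j (fun _ : Fin k → EuclideanSpace ℝ (Fin n) => c) :=
  extendable_const _

theorem PlaneExtendable.analyticAt (hb : b ≠ a) (hj : j ≠ a) (H : PlaneExtendable a b j Y) :
    AnalyticAt ℝ Y 0 := by
  obtain ⟨S, hS⟩ := H _ subset_rfl (realizable_startGerms hb)
  exact (hS _ (Or.inl rfl)).analyticAt hj

theorem PlaneExtendable.dyad (hj : j ≠ a) (H : PlaneExtendable a b j Y) (hY0 : Y 0 ≠ 0)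
    {R r s : ℝ} (hR : 0 < R) (hr : 0 < r) (hs : s = 1 ∨ s = -1) (hd : 0 < dyadDisc R r (Y 0)) :
    PlaneExtendable a b j fun z => _root_.dyad R r s (Y z) := by
  intro G hG hr'
  refine ((H G hG hr').dyad hj (Set.mem_insert _ _) hY0 hR hr hs hd).mono ?_
  exact Set.insert_subset_insert (Set.subset_insert _ _)

/-- Inversion in the unit circle. -/
theorem PlaneExtendable.inversion (hb : b ≠ a) (hj : j ≠ a) (H : PlaneExtendable a b j Y)
    (hY0 : Y 0 ≠ 0) : PlaneExtendable a b j fun z => (starRingEnd ℂ (Y z))⁻¹ := by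
  have hl : 0 < ‖Y 0‖ := norm_pos_iff.2 hY0
  -- With radii `√2 * ‖Y 0‖` and `‖Y 0‖` the discriminant at the base point is `1`, and `R ^ 2 - r ^
  -- 2 = ‖Y 0‖ ^ 2` is the factor divided out below.
  have hR : 0 < √2 * ‖Y 0‖ := by positivity
  have hR2 : (√2 * ‖Y 0‖) ^ 2 = 2 * ‖Y 0‖ ^ 2 := by
    rw [mul_pow, Real.sq_sqrt (by norm_num)]
  have hd : 0 < dyadDisc (√2 * ‖Y 0‖) ‖Y 0‖ (Y 0) := by
    have : dyadDisc (√2 * ‖Y 0‖) ‖Y 0‖ (Y 0) = 1 := by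
      rw [dyadDisc, Complex.normSq_eq_norm_sq, hR2]
      field_simp
      norm_num
    rw [this]
    exact one_pos
  have key := ((((H.dyad hj hY0 hR hl (Or.inl rfl) hd).real_mul (√2 * ‖Y 0‖)).add
    ((H.dyad hj hY0 hR hl (Or.inr rfl) hd).real_mul (√2 * ‖Y 0‖))).sub H).real_mul
    (‖Y 0‖ ^ 2)⁻¹
  refine key.congr ?_
  filter_upwards [(H.analyticAt hb hj).continuousAt.eventually_ne hY0] with z hz
  rw [dyad_add_dyad_sub hz hR, hR2, ← mul_assoc, ← Complex.ofReal_mul]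
  have : (‖Y 0‖ ^ 2)⁻¹ * (2 * ‖Y 0‖ ^ 2 - ‖Y 0‖ ^ 2) = 1 := by
    field_simp
    norm_num
  rw [this, Complex.ofReal_one, one_mul]

/-- Since `1 / w - 1 / (w + 1) = 1 / (w * (w + 1))`, three inversions produce `w ^ 2 + w`; the
conjugations cancel. The shift `w = Y + c` with real `c > ‖Y 0‖` keeps all denominators nonzero at
the base point, and `2 * c * Y` is only a real multiple. -/
theorem PlaneExtendable.sq (hb : b ≠ a) (hj : j ≠ a) (H : PlaneExtendable a b j Y) :
    PlaneExtendable a b j fun z => Y z ^ 2 := by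
  set c : ℝ := ‖Y 0‖ + 1
  have hre : 0 < (Y 0 + c).re := by
    have := (abs_le.1 (Complex.abs_re_le_norm (Y 0))).1
    simp only [Complex.add_re, Complex.ofReal_re, c]
    linarith
  have h1 : Y 0 + c ≠ 0 := fun h => by rw [h] at hre; simp at hre
  have h2 : Y 0 + c + 1 ≠ 0 := fun h => by
    have := congrArg Complex.re h
    rw [Complex.add_re, Complex.one_re, Complex.zero_re] at this
    linarith
  have X := H.add (planeExtendable_const (a := a) (b := b) (j := j) (c : ℂ))
  have X' := X.add (planeExtendable_const (a := a) (b := b) (j := j) (1 : ℂ))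
  have D := (X.inversion hb hj h1).sub (X'.inversion hb hj h2)
  have hDeq : ∀ w : ℂ, w ≠ 0 → w + 1 ≠ 0 →
      (starRingEnd ℂ w)⁻¹ - (starRingEnd ℂ (w + 1))⁻¹ = starRingEnd ℂ ((w * (w + 1))⁻¹) := by
    intro w h h'
    rw [← map_inv₀, ← map_inv₀, ← map_sub]
    congr 1
    field_simp
    ring
  have hD0 : (starRingEnd ℂ (Y 0 + c))⁻¹ - (starRingEnd ℂ (Y 0 + c + 1))⁻¹ ≠ 0 := by
    rw [hDeq _ h1 h2]
    exact (map_ne_zero _).2 (inv_ne_zero (mul_ne_zero h1 h2))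
  have key := ((D.inversion hb hj hD0).sub X).sub ((H.real_mul (2 * c)).add
    (planeExtendable_const (a := a) (b := b) (j := j) ((c : ℂ) ^ 2)))
  refine key.congr ?_
  filter_upwards [(X.analyticAt hb hj).continuousAt.eventually_ne h1,
    (X'.analyticAt hb hj).continuousAt.eventually_ne h2] with z hz1 hz2
  rw [hDeq _ hz1 hz2, Complex.conj_conj, inv_inv]
  push_cast
  ring

theorem PlaneExtendable.mul (hb : b ≠ a) (hj : j ≠ a) (H : PlaneExtendable a b j Y)
    (H' : PlaneExtendable a b j Y') : PlaneExtendable a b j fun z => Y z * Y' z := by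
  have key := ((((H.add H').sq hb hj).sub (H.sq hb hj)).sub (H'.sq hb hj)).real_mul (1 / 2)
  refine key.congr (Eventually.of_forall fun z => ?_)
  push_cast
  ring

/-- Reflection of a unit vector. -/
theorem PlaneExtendable.conj (hb : b ≠ a) (hj : j ≠ a) (H : PlaneExtendable a b j Y)
    (hY : ∀ᶠ z in 𝓝 0, ‖Y z‖ = 1) (hY0 : Y 0 = 1) :
    PlaneExtendable a b j fun z => starRingEnd ℂ (Y z) := by
  have hone := planeExtendable_const (k := k) (a := a) (b := b) (j := j) (1 : ℂ)
  -- On the unit circle `1 - 1 / (conj w + 1) = 1 / (w + 1)`, and inverting once more gives `conj w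
  -- + 1`. The value `1` at the base point keeps `w + 1` away from zero.
  have X := H.add hone
  have hX0 : Y 0 + 1 ≠ 0 := by rw [hY0]; norm_num
  have Z := hone.sub (X.inversion hb hj hX0)
  have hZ : ∀ w : ℂ, ‖w‖ = 1 → w + 1 ≠ 0 →
      1 - (starRingEnd ℂ (w + 1))⁻¹ = (w + 1)⁻¹ := by
    intro w hw h
    have hw' : w * starRingEnd ℂ w = 1 := by
      rw [Complex.mul_conj, Complex.normSq_eq_norm_sq, hw]; norm_num
    have h' : starRingEnd ℂ w + 1 ≠ 0 := by
      have : starRingEnd ℂ (w + 1) ≠ 0 := (map_ne_zero _).2 h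
      simpa using this
    rw [map_add, map_one]
    field_simp
    linear_combination hw'
  have hZ0 : 1 - (starRingEnd ℂ (Y 0 + 1))⁻¹ ≠ 0 := by
    rw [hZ _ (by rw [hY0]; simp) hX0]
    exact inv_ne_zero hX0
  refine ((Z.inversion hb hj hZ0).sub hone).congr ?_
  filter_upwards [hY, (X.analyticAt hb hj).continuousAt.eventually_ne hX0] with z h1 h2
  rw [hZ _ h1 h2, map_inv₀, inv_inv, map_add, map_one, add_sub_cancel_right]

/-- Real germs are extendable in one coordinate plane if they are in another. -/
theorem PlaneExtendable.of_real {f : (Fin k → EuclideanSpace ℝ (Fin n)) → ℝ} {j' : Fin n}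
    (H : PlaneExtendable a b j fun z => (f z : ℂ)) :
    PlaneExtendable a b j' fun z => (f z : ℂ) := by
  refine Extendable.congr H (Eventually.of_forall fun z => ?_)
  simp [planeEmb_apply]

/-- The coordinate is the imaginary part of an initial unit vector `Y`, that is `(Y - conj Y) * (-i
/ 2)`. Being real, it can be moved to any plane. -/
theorem planeExtendable_coord (hb : b ≠ a) (l : Fin k) (i : Fin n) :
    PlaneExtendable a b j (fun z : Fin k → EuclideanSpace ℝ (Fin n) => (z l i : ℂ)) := by
  have hi : (if i = a then b else i) ≠ a := by
    split_ifs with h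
    · exact hb
    · exact h
  have H : PlaneExtendable a b (if i = a then b else i)
      (fun z : Fin k → EuclideanSpace ℝ (Fin n) => (⟨√(1 - z l i ^ 2), z l i⟩ : ℂ)) := by
    intro G hG hr
    refine hr.mono ?_
    rintro x (rfl | hx)
    · exact hG ⟨l, i, rfl⟩
    · exact hx
  have hnorm : ∀ᶠ z : Fin k → EuclideanSpace ℝ (Fin n) in 𝓝 0,
      ‖(⟨√(1 - z l i ^ 2), z l i⟩ : ℂ)‖ = 1 := by
    have hc : Continuous fun z : Fin k → EuclideanSpace ℝ (Fin n) => 1 - z l i ^ 2 := by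
      fun_prop
    filter_upwards [hc.continuousAt.eventually (lt_mem_nhds (a := 0) (by simp))] with z hz
    rw [norm_eq_iff_normSq zero_le_one, Complex.normSq_mk, Real.mul_self_sqrt hz.le]
    ring
  have C := H.conj hb hi hnorm (by apply Complex.ext <;> simp)
  refine PlaneExtendable.of_real (((H.sub C).mul hb hi
    (planeExtendable_const (-Complex.I / 2))).congr (Eventually.of_forall fun z => ?_))
  apply Complex.ext
  · simp; ring
  · simp

theorem planeExtendable_eval (hb : b ≠ a) (hj : j ≠ a) (P : MvPolynomial (Fin k × Fin n) ℝ) :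
    PlaneExtendable a b j (fun z : Fin k → EuclideanSpace ℝ (Fin n) =>
      ((MvPolynomial.eval (fun p : Fin k × Fin n => z p.1 p.2) P : ℝ) : ℂ)) := by
  induction P using MvPolynomial.induction_on with
  | C c => simpa using planeExtendable_const (c : ℂ)
  | add p q hp hq => simpa using hp.add hq
  | mul_X p i hp => simpa using hp.mul hb hj (planeExtendable_coord hb i.1 i.2)

/-- Polynomial germs are extendable. -/
theorem extendable_eval_smul_single (hb : b ≠ a) (P : MvPolynomial (Fin k × Fin n) ℝ)
    (i : Fin n) : Extendable a b (fun z : Fin k → EuclideanSpace ℝ (Fin n) =>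
      MvPolynomial.eval (fun p : Fin k × Fin n => z p.1 p.2) P •
        EuclideanSpace.single i (1 : ℝ)) := by
  by_cases hi : i = a
  · subst hi
    refine Extendable.congr (planeExtendable_eval hb hb P) (Eventually.of_forall fun z => ?_)
    simp [planeEmb_apply]
  -- Multiplication by the imaginary unit in the plane of `a` and `i` turns the direction `a` into
  -- the direction `i`.
  · refine Extendable.congr ((planeExtendable_eval hb hi P).mul hb hi
      (planeExtendable_const Complex.I)) (Eventually.of_forall fun z => ?_)
    simp [planeEmb_apply]

/-- Finitely many extendable germs are realized by one local system. -/
theorem exists_localSystem_of_extendable (hb : b ≠ a)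
    (G : Finset ((Fin k → EuclideanSpace ℝ (Fin n)) → EuclideanSpace ℝ (Fin n)))
    (hG : ∀ h ∈ G, Extendable a b h) :
    ∃ S : LocalSystem n k a, ∀ h ∈ G, S.Represents h := by
  classical
  have key : Realizable a (startGerms k a b ∪ G) := by
    induction G using Finset.induction_on with
    | empty => simpa using realizable_startGerms hb
    | insert h G _ ih =>
      have := hG h (Finset.mem_insert_self _ _) _ Set.subset_union_left
        (ih fun x hx => hG x (Finset.mem_insert_of_mem hx))
      rwa [Finset.coe_insert, Set.union_insert]
  obtain ⟨S, hS⟩ := key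
  exact ⟨S, fun h hh => hS h (Or.inr hh)⟩

end Extendable

/-! ### From germs at the origin to a compact set -/

section PlanarSystem

variable {n k m : ℕ} {a b : Fin n}

theorem comb_sum {I D : Type} [Fintype I] (pl : I → Fin n) (s : Finset D) (t : D → I → ℝ)
    (y : D → EuclideanSpace ℝ (Fin n)) (ω : I → ℂ) :
    comb a pl (∑ d ∈ s, t d) (∑ d ∈ s, y d) ω = ∑ d ∈ s, comb a pl (t d) (y d) ω := by
  classical
  induction s using Finset.induction_on with
  | empty => simp [comb]
  | insert d s hd ih => rw [Finset.sum_insert hd, Finset.sum_insert hd, Finset.sum_insert hd,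
      comb_add, ih]

/-- A monomial of degree `d` at `x` is `c ^ d` times its value at `c⁻¹ • x`. The scale enters only
through the coefficients, so one system serves all `c`. -/
theorem exists_comb_eq_polynomial {I : Type} [Fintype I] (pl : I → Fin n)
    (D : Finset (Fin k × Fin n →₀ ℕ)) (t : (Fin k × Fin n →₀ ℕ) → Fin n → I → ℝ)
    (y : (Fin k × Fin n →₀ ℕ) → Fin n → EuclideanSpace ℝ (Fin n)) {c : ℝ} (hc : c ≠ 0)
    (p : Fin n → MvPolynomial (Fin k × Fin n) ℝ) (hp : ∀ i, (p i).support ⊆ D) :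
    ∃ (t' : I → ℝ) (y' : EuclideanSpace ℝ (Fin n)),
      ∀ (x : Fin k → EuclideanSpace ℝ (Fin n)) (ω : I → ℂ),
      (∀ d ∈ D, ∀ i, comb a pl (t d i) (y d i) ω =
        (∏ q, ((c⁻¹ • x) q.1 q.2) ^ d q) • EuclideanSpace.single i (1 : ℝ)) →
      comb a pl t' y' ω = ∑ i, MvPolynomial.eval (fun q : Fin k × Fin n => x q.1 q.2) (p i) •
        EuclideanSpace.single i (1 : ℝ) := by
  refine ⟨∑ i, ∑ d ∈ (p i).support, ((p i).coeff d * c ^ ∑ q, d q) • t d i,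
    ∑ i, ∑ d ∈ (p i).support, ((p i).coeff d * c ^ ∑ q, d q) • y d i, fun x ω h => ?_⟩
  rw [comb_sum]
  refine Finset.sum_congr rfl fun i _ => ?_
  rw [comb_sum, MvPolynomial.eval_eq', Finset.sum_smul]
  refine Finset.sum_congr rfl fun d hd => ?_
  rw [comb_smul, h d (hp i hd) i, smul_smul, mul_assoc]
  congr 2
  rw [← Finset.prod_pow_eq_pow_sum, ← Finset.prod_mul_distrib]
  refine Finset.prod_congr rfl fun q _ => ?_
  rw [← mul_pow]
  congr 1
  simp [hc]

/-- For a polynomial map and a compact set there is a planar system whose solutions near a base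
point are parametrized by a neighbourhood of the compact set, in such a way that the argument
and the value of the map are affine combinations of the vectors of the system. -/
theorem exists_planar_system (hb : b ≠ a)
    (f : (Fin k → EuclideanSpace ℝ (Fin n)) → (Fin m → EuclideanSpace ℝ (Fin n)))
    (hf : IsPolynomialMap f) (K : Set (Fin k → EuclideanSpace ℝ (Fin n))) (hK : IsCompact K) :
    ∃ (I B : Type) (_ : Fintype I) (_ : Fintype B) (pl : I → Fin n) (con : B → I → ℝ)
      (cst : B → EuclideanSpace ℝ (Fin n)) (ω₀ : I → ℂ) (ρ : ℝ), (∀ i, pl i ≠ a) ∧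
      (∀ i, ‖ω₀ i‖ = 1) ∧ 0 < ρ ∧ ∀ ρ' > 0, ∃ (t : Fin k ⊕ Fin m → I → ℝ)
        (y : Fin k ⊕ Fin m → EuclideanSpace ℝ (Fin n))
        (W : Set (Fin k → EuclideanSpace ℝ (Fin n)))
        (G : (Fin k → EuclideanSpace ℝ (Fin n)) → I → ℂ), K ⊆ W ∧ AnalyticOnNhd ℝ G W ∧
        (∀ x ∈ W, ∀ i, ‖G x i‖ = 1) ∧ (∀ x ∈ W, ∀ b, ‖comb a pl (con b) (cst b) (G x)‖ = 1) ∧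
        (∀ x ∈ W, ∀ l, comb a pl (t (Sum.inl l)) (y (Sum.inl l)) (G x) = x l) ∧
        (∀ x ∈ W, ∀ l, comb a pl (t (Sum.inr l)) (y (Sum.inr l)) (G x) = f x l) ∧
        (∀ ω, (∀ i, ‖ω i‖ = 1) → (∀ b, ‖comb a pl (con b) (cst b) ω‖ = 1) → ‖ω - ω₀‖ ≤ ρ →
          ∃ x ∈ W, ω = G x) ∧
        ∀ x ∈ K, ‖G x - ω₀‖ < ρ' := by
  classical
  obtain ⟨P, hP⟩ := hf
  -- Besides the monomials of `f`, the degree-one monomials are included, since the inputs must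
  -- appear as vertices too.
  let D : Finset (Fin k × Fin n →₀ ℕ) :=
    (Finset.univ.biUnion fun p : Fin m × Fin n => (P p.1 p.2).support) ∪
      Finset.univ.image fun p : Fin k × Fin n => Finsupp.single p 1
  let germ : (Fin k × Fin n →₀ ℕ) → Fin n → (Fin k → EuclideanSpace ℝ (Fin n)) →
      EuclideanSpace ℝ (Fin n) := fun d i z =>
    (∏ q, (z q.1 q.2) ^ d q) • EuclideanSpace.single i (1 : ℝ)
  have hgerm : ∀ d i, Extendable a b (germ d i) := fun d i => by
    have := extendable_eval_smul_single (k := k) hb (MvPolynomial.monomial d 1) i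
    simpa [MvPolynomial.eval_monomial, Finsupp.prod_fintype] using this
  obtain ⟨S, hS⟩ := exists_localSystem_of_extendable hb
    ((D ×ˢ Finset.univ).image fun p : (Fin k × Fin n →₀ ℕ) × Fin n => germ p.1 p.2) (by
      intro h hh
      obtain ⟨p, -, rfl⟩ := Finset.mem_image.1 hh
      exact hgerm _ _)
  have hS' : ∀ d i, ∃ t y, d ∈ D → ∀ᶠ z in 𝓝 0, comb a S.pl t y (S.g z) = germ d i z := by
    intro d i
    by_cases hd : d ∈ D
    · obtain ⟨t, y, h⟩ := hS (germ d i) (Finset.mem_image.2 ⟨(d, i), by simpa using hd, rfl⟩)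
      exact ⟨t, y, fun _ => h⟩
    · exact ⟨0, 0, fun h => absurd h hd⟩
  choose t₀ y₀ hty using hS'
  have hrep : ∀ᶠ z in 𝓝 0, ∀ d ∈ D, ∀ i, comb a S.pl (t₀ d i) (y₀ d i) (S.g z) = germ d i z := by
    rw [Finset.eventually_all]
    intro d hd
    rw [eventually_all]
    exact fun i => hty d i hd
  have hgood := S.analytic.eventually_analyticAt.and (S.norm_g.and (S.con_g.and hrep))
  have hQ : Tendsto S.Q (𝓝 (S.g 0)) (𝓝 0) := by
    have := S.continuous_Q.tendsto (S.g 0)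
    rwa [S.Q_g] at this
  obtain ⟨ρ, hρ, hball⟩ := Metric.eventually_nhds_iff.1 (S.eq_g.and (hQ.eventually hgood))
  -- Half the radius puts a closed ball inside the open ball of uniqueness. System and radius are
  -- fixed before `ρ'`; only the scale depends on `ρ'`.
  refine ⟨S.I, S.B, inferInstance, inferInstance, S.pl, S.con, S.cst, S.g 0, ρ / 2, S.pl_ne,
    S.norm_g.self_of_nhds, half_pos hρ, fun ρ' hρ' => ?_⟩
  have hnear : ∀ᶠ z in 𝓝 0, ‖S.g z - S.g 0‖ < ρ' := by
    have := S.analytic.continuousAt.eventually (Metric.ball_mem_nhds (S.g 0) hρ')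
    simpa only [Metric.mem_ball, dist_eq_norm] using this
  obtain ⟨δ, hδ, hδball⟩ := Metric.eventually_nhds_iff.1 (hgood.and hnear)
  obtain ⟨M, hM, hKM⟩ := hK.isBounded.exists_pos_norm_le
  -- As `K` lies in the ball of radius `M`, this scale brings `c⁻¹ • K` inside the ball of radius
  -- `δ`.
  let c : ℝ := (M + 1) / δ
  have hc : 0 < c := by positivity
  have hKc : ∀ x ∈ K, dist (c⁻¹ • x) 0 < δ := by
    intro x hx
    rw [dist_zero_right, norm_smul, norm_inv, Real.norm_eq_abs, abs_of_pos hc, inv_mul_lt_iff₀ hc]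
    have : c * δ = M + 1 := by simp only [c]; field_simp
    rw [this]
    linarith [hKM x hx]
  have hpoly : ∀ p : Fin n → MvPolynomial (Fin k × Fin n) ℝ, (∀ i, (p i).support ⊆ D) → _ :=
    fun p hp => exists_comb_eq_polynomial (a := a) S.pl D t₀ y₀ hc.ne' p hp
  have hin : ∀ l : Fin k, ∀ i,
      (MvPolynomial.X (l, i) : MvPolynomial (Fin k × Fin n) ℝ).support ⊆ D := by
    intro l i
    rw [MvPolynomial.support_X, Finset.singleton_subset_iff]
    exact Finset.mem_union_right _ (Finset.mem_image.2 ⟨(l, i), Finset.mem_univ _, rfl⟩)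
  have hout : ∀ l i, (P l i).support ⊆ D := fun l i d hd =>
    Finset.mem_union_left _ (Finset.mem_biUnion.2 ⟨(l, i), Finset.mem_univ _, hd⟩)
  choose ti yi hi using fun l => hpoly _ (hin l)
  choose tO yO hO using fun l => hpoly _ (hout l)
  refine ⟨Sum.elim ti tO, Sum.elim yi yO,
    {x | AnalyticAt ℝ S.g (c⁻¹ • x) ∧ (∀ i, ‖S.g (c⁻¹ • x) i‖ = 1) ∧
    (∀ b, ‖comb a S.pl (S.con b) (S.cst b) (S.g (c⁻¹ • x))‖ = 1) ∧
    ∀ d ∈ D, ∀ i, comb a S.pl (t₀ d i) (y₀ d i) (S.g (c⁻¹ • x)) = germ d i (c⁻¹ • x)},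
    fun x => S.g (c⁻¹ • x), fun x hx => (hδball (hKc x hx)).1, fun x hx => ?_, fun x hx => hx.2.1,
    fun x hx => hx.2.2.1, fun x hx l => ?_, fun x hx l => ?_, fun ω h1 h2 h3 => ?_,
    fun x hx => (hδball (hKc x hx)).2⟩
  · exact hx.1.comp (((c⁻¹) • ContinuousLinearMap.id ℝ _ :
      (Fin k → EuclideanSpace ℝ (Fin n)) →L[ℝ] _).analyticAt x)
  · refine (hi l x _ hx.2.2.2).trans ?_
    simp only [MvPolynomial.eval_X]
    exact sum_smul_single (x l)
  · refine (hO l x _ hx.2.2.2).trans ?_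
    simp only [← hP]
    exact sum_smul_single (f x l)
  · have hd : dist ω (S.g 0) < ρ := by rw [dist_eq_norm]; linarith
    obtain ⟨e1, e2⟩ := hball hd
    refine ⟨c • S.Q ω, ?_, ?_⟩
    · have : c⁻¹ • c • S.Q ω = S.Q ω := inv_smul_smul₀ hc.ne' _
      simpa only [Set.mem_ofPred_eq, this] using e2
    · change ω = S.g (c⁻¹ • c • S.Q ω)
      rw [inv_smul_smul₀ hc.ne']
      exact e1 h1 h2

end PlanarSystem

/-! ### Trivial covers from disjoint sections -/

section Cover

/-- Finitely many disjoint analytic sections over a compact set that exhaust the fibres form an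
analytically trivial cover. -/
theorem isAnalyticallyTrivialCover_of_sections {E B : Type*} [NormedAddCommGroup E]
    [NormedSpace ℝ E] [NormedAddCommGroup B] [NormedSpace ℝ B] {q : E → B}
    {C : Set E} {U : Set B} (hq : ∀ φ, AnalyticAt ℝ q φ) (hU : IsCompact U) {ι : Type} [Finite ι]
    [Nonempty ι] (sec : ι → B → E) (han : ∀ i, AnalyticOnNhd ℝ (sec i) U)
    (hC : ∀ i, ∀ x ∈ U, sec i x ∈ C) (hqs : ∀ i, ∀ x ∈ U, q (sec i x) = x)
    (hsurj : ∀ φ ∈ C, q φ ∈ U → ∃ i, φ = sec i (q φ))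
    (hne : ∀ x ∈ U, ∀ i j, i ≠ j → sec i x ≠ sec j x) : IsAnalyticallyTrivialCover q C U := by
  classical
  obtain ⟨N, ⟨e⟩⟩ := Finite.exists_equiv_fin ι
  let val : ι → ℝ := fun i => ((e i : ℕ) : ℝ)
  -- The sheets are labelled by integers and `lookup` rounds to the nearest one, so it is locally
  -- constant near each label and the parametrization is analytic there.
  let lookup : ℝ → ι := fun s => if h : ∃ i, ⌊s + 1 / 2⌋ = ((e i : ℕ) : ℤ) then h.choose else
    Classical.arbitrary ι
  have hlookup : ∀ i, ∀ s : ℝ, val i - 1 / 2 < s → s < val i + 1 / 2 → lookup s = i := by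
    intro i s h1 h2
    have hfl : ⌊s + 1 / 2⌋ = ((e i : ℕ) : ℤ) := by
      rw [Int.floor_eq_iff]
      simp only [val] at h1 h2
      push_cast
      constructor <;> linarith
    have hex : ∃ i, ⌊s + 1 / 2⌋ = ((e i : ℕ) : ℤ) := ⟨i, hfl⟩
    have hs := hfl.symm.trans hex.choose_spec
    simp only [lookup, dif_pos hex]
    exact e.injective (Fin.ext (by exact_mod_cast hs.symm))
  have hlookup' : ∀ i, lookup (val i) = i := fun i => hlookup i _ (by linarith) (by linarith)
  have hcpt : ∀ i, IsCompact (sec i '' U) := fun i => hU.image_of_continuousOn (han i).continuousOn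
  have hdisj : ∀ i j, i ≠ j → Disjoint (sec i '' U) (sec j '' U) := by
    intro i j hij
    rw [Set.disjoint_left]
    rintro _ ⟨x, hx, rfl⟩ ⟨x', hx', h⟩
    have hxx : x' = x := by rw [← hqs j x' hx', h, hqs i x hx]
    subst hxx
    exact hne x' hx' i j hij h.symm
  -- Disjoint compact sheets have disjoint neighbourhoods, on which the sheet label is constant.
  -- This makes the inverse analytic.
  have hδ : ∃ δ > 0, ∀ i j, i ≠ j →
      Disjoint (Metric.thickening δ (sec i '' U)) (Metric.thickening δ (sec j '' U)) := by
    have : ∀ᶠ δ in 𝓝[>] (0 : ℝ), ∀ i j, i ≠ j →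
        Disjoint (Metric.thickening δ (sec i '' U)) (Metric.thickening δ (sec j '' U)) := by
      rw [eventually_all]
      intro i
      rw [eventually_all]
      intro j
      by_cases hij : i = j
      · exact Eventually.of_forall fun _ h => absurd hij h
      · obtain ⟨δ, hδ, h⟩ := (hdisj i j hij).exists_thickenings (hcpt i) (hcpt j).isClosed
        filter_upwards [Ioc_mem_nhdsGT hδ] with δ' hδ' _
        exact h.mono (Metric.thickening_mono hδ'.2 _) (Metric.thickening_mono hδ'.2 _)
    obtain ⟨δ, h1, h2⟩ := (this.and self_mem_nhdsWithin).exists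
    exact ⟨δ, h2, h1⟩
  obtain ⟨δ, hδ, hthick⟩ := hδ
  let label : E → ι := fun φ => if h : ∃ i, φ ∈ Metric.thickening δ (sec i '' U) then h.choose else
    Classical.arbitrary ι
  have hlabel : ∀ i, ∀ φ ∈ Metric.thickening δ (sec i '' U), label φ = i := by
    intro i φ hφ
    have hex : ∃ i, φ ∈ Metric.thickening δ (sec i '' U) := ⟨i, hφ⟩
    simp only [label, dif_pos hex]
    by_contra hne
    exact Set.disjoint_left.1 (hthick _ _ hne) hex.choose_spec hφ
  have hlabel' : ∀ i, ∀ x ∈ U, label (sec i x) = i := fun i x hx =>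
    hlabel i _ (Metric.self_subset_thickening hδ _ ⟨x, hx, rfl⟩)
  have hmem : ∀ z ∈ U ×ˢ Set.range val, ∃ i, z.2 = val i ∧ z.1 ∈ U := by
    rintro ⟨x, s⟩ ⟨hx, ⟨i, rfl⟩⟩
    exact ⟨i, rfl, hx⟩
  refine ⟨Set.range val, fun z => sec (lookup z.2) z.1, Set.finite_range val,
    ⟨⟨?_, ?_, ?_⟩, ?_, ?_⟩, ?_⟩
  · intro z hz
    obtain ⟨i, hi, hx⟩ := hmem z hz
    simp only [hi, hlookup', Set.mem_inter_iff, Set.mem_preimage]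
    exact ⟨hC i _ hx, by rw [hqs i _ hx]; exact hx⟩
  · intro z hz z' hz' h
    obtain ⟨i, hi, hx⟩ := hmem z hz
    obtain ⟨j, hj, hx'⟩ := hmem z' hz'
    simp only [hi, hj, hlookup'] at h
    have h1 : z.1 = z'.1 := by rw [← hqs i _ hx, h, hqs j _ hx']
    have h2 : i = j := by rw [← hlabel' i _ hx, h, hlabel' j _ hx']
    exact Prod.ext h1 (by rw [hi, hj, h2])
  · rintro φ ⟨hφ, hφU⟩
    obtain ⟨i, hi⟩ := hsurj φ hφ hφU
    exact ⟨(q φ, val i), ⟨hφU, i, rfl⟩, by simp only [hlookup']; exact hi.symm⟩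
  · refine ⟨_, fun z hz => ?_, Set.eqOn_refl _ _⟩
    obtain ⟨i, hi, hx⟩ := hmem z hz
    have h1 : AnalyticAt ℝ (fun z : B × ℝ => sec i z.1) z := (han i z.1 hx).comp analyticAt_fst
    refine h1.congr ?_
    have h2 : ∀ᶠ z' : B × ℝ in 𝓝 z, val i - 1 / 2 < z'.2 ∧ z'.2 < val i + 1 / 2 := by
      have h3 : ∀ᶠ s in 𝓝 z.2, val i - 1 / 2 < s ∧ s < val i + 1 / 2 := by
        rw [hi]
        exact (lt_mem_nhds (by linarith)).and (gt_mem_nhds (by linarith))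
      exact (continuous_snd.tendsto z).eventually h3
    filter_upwards [h2] with z' hz'
    rw [hlookup i z'.2 hz'.1 hz'.2]
  · refine ⟨fun φ => (q φ, val (label φ)), ?_, fun z hz => ?_⟩
    · rintro φ ⟨hφ, hφU⟩
      obtain ⟨i, hi⟩ := hsurj φ hφ hφU
      have h1 : AnalyticAt ℝ (fun φ => (q φ, val i)) φ := (hq φ).prod analyticAt_const
      refine h1.congr ?_
      have hm : φ ∈ Metric.thickening δ (sec i '' U) :=
        Metric.self_subset_thickening hδ _ ⟨q φ, hφU, hi.symm⟩
      filter_upwards [Metric.isOpen_thickening.mem_nhds hm] with φ' hφ'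
      rw [hlabel i φ' hφ']
    · obtain ⟨i, hi, hx⟩ := hmem z hz
      simp only [hi, hlookup', hlabel' i _ hx, hqs i _ hx]
      exact Prod.ext rfl hi.symm
  · intro z hz
    obtain ⟨i, hi, hx⟩ := hmem z hz
    simp only [hi, hlookup', hqs i _ hx]

theorem analyticAt_eval {n k : ℕ} {V : Type} [Fintype V] (L : CabledLinkage n V) (w : Fin k → V)
    (φ : V → EuclideanSpace ℝ (Fin n)) : AnalyticAt ℝ (L.eval w) φ :=
  AnalyticAt.pi fun i => (ContinuousLinearMap.proj (R := ℝ)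
    (φ := fun _ : V => EuclideanSpace ℝ (Fin n)) (w i)).analyticAt φ

theorem analyticAt_comb_comp {n k : ℕ} {I V : Type} [Fintype I] [Fintype V] {a : Fin n}
    (pl : I → Fin n) (T : V → I → ℝ) (Y : V → EuclideanSpace ℝ (Fin n))
    {G : (Fin k → EuclideanSpace ℝ (Fin n)) → I → ℂ} {x : Fin k → EuclideanSpace ℝ (Fin n)}
    (hG : AnalyticAt ℝ G x) : AnalyticAt ℝ (fun x v => comb a pl (T v) (Y v) (G x)) x :=
  AnalyticAt.pi fun v => (analyticAt_comb a pl (T v) (Y v) (G x)).comp hG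

end Cover

/-! ### Confinement by cables -/

section Main

variable {n k m : ℕ} {a b : Fin n}

/-- One cable per unit vector imposes `‖ω i - ω₀ i‖ ≤ ρ`, rescaled to bound `1`. The surviving
solutions are values of `G`, so the input vertices determine the configuration analytically. -/
theorem exists_stronglyFunctional (hb : b ≠ a)
    (f : (Fin k → EuclideanSpace ℝ (Fin n)) → (Fin m → EuclideanSpace ℝ (Fin n)))
    (hf : IsPolynomialMap f) (K : Set (Fin k → EuclideanSpace ℝ (Fin n))) (hK : IsCompact K) :
    ∃ (V : Type) (_ : Fintype V) (L : CabledLinkage n V) (w : Fin k → V) (v : Fin m → V),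
      Function.Injective (Sum.elim w v) ∧ L.IsStronglyFunctional w v f K := by
  classical
  obtain ⟨I, B, _, _, pl, con, cst, ω₀, ρ, hpl, -, hρ, H⟩ := exists_planar_system hb f hf K hK
  obtain ⟨t, y, W, G, hKW, hG, hGn, hGc, hin, hout, huniq, hnear⟩ := H ρ hρ
  obtain ⟨V, _, L, out, -, T, Y, -, hinj, hTY, -, hconf⟩ := exists_linkage_of_planar_system a pl hpl
    con cst (fun i => Pi.single i ρ⁻¹) (fun i => -(ρ⁻¹ • planeEmb a (pl i) (ω₀ i))) t y
  have hcable : ∀ ω : I → ℂ, (∀ i, ‖comb a pl (Pi.single i ρ⁻¹)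
      (-(ρ⁻¹ • planeEmb a (pl i) (ω₀ i))) ω‖ ≤ 1) ↔ ‖ω - ω₀‖ ≤ ρ := by
    intro ω
    rw [pi_norm_le_iff_of_nonneg hρ.le]
    refine forall_congr' fun i => ?_
    have : comb a pl (Pi.single i ρ⁻¹) (-(ρ⁻¹ • planeEmb a (pl i) (ω₀ i))) ω
        = ρ⁻¹ • planeEmb a (pl i) (ω i - ω₀ i) := by
      rw [map_sub, smul_sub, sub_eq_add_neg]
      simp [comb, Pi.single_apply, ite_smul]
    rw [this, norm_smul, norm_planeEmb (hpl i), norm_inv, Real.norm_eq_abs, abs_of_pos hρ,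
      inv_mul_le_iff₀ hρ, mul_one, Pi.sub_apply]
  have hmem : ∀ φ ∈ L.configSpace, ∃ x ∈ W, φ = (fun v => comb a pl (T v) (Y v) (G x)) ∧
      L.eval (out ∘ Sum.inl) φ = x ∧ L.eval (out ∘ Sum.inr) φ = f x := by
    intro φ hφ
    rw [hconf] at hφ
    obtain ⟨ω, h1, h2, h3, rfl⟩ := hφ
    obtain ⟨x, hx, rfl⟩ := huniq ω h1 h2 ((hcable ω).1 h3)
    exact ⟨x, hx, rfl, funext fun l => (hTY _ _).trans (hin x hx l),
      funext fun l => (hTY _ _).trans (hout x hx l)⟩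
  refine ⟨V, inferInstance, L, out ∘ Sum.inl, out ∘ Sum.inr, ?_, fun φ hφ => ?_, fun x hx => ?_,
    ⟨fun φ hφ => Set.mem_image_of_mem _ hφ, fun φ hφ φ' hφ' h => ?_, fun x hx => hx⟩,
    ⟨L.eval (out ∘ Sum.inl), fun φ _ => analyticAt_eval L _ φ, Set.eqOn_refl _ _⟩,
    fun x v => comb a pl (T v) (Y v) (G x), ?_, fun φ hφ => ?_⟩
  · rwa [Sum.elim_comp_inl_inr]
  · obtain ⟨x, -, -, h1, h2⟩ := hmem φ hφ
    rw [h1, h2]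
  · have hmc : (fun v => comb a pl (T v) (Y v) (G x)) ∈ L.configSpace := by
      rw [hconf]
      exact ⟨G x, hGn x (hKW hx), hGc x (hKW hx), (hcable _).2 (hnear x hx).le, rfl⟩
    exact ⟨_, hmc, funext fun l => (hTY _ _).trans (hin x (hKW hx) l)⟩
  · obtain ⟨x, -, e, h1, -⟩ := hmem φ hφ
    obtain ⟨x', -, e', h1', -⟩ := hmem φ' hφ'
    have : x = x' := by rw [← h1, ← h1', h]
    rw [e, e', this]
  · rintro _ ⟨φ, hφ, rfl⟩
    obtain ⟨x, hx, -, h1, -⟩ := hmem φ hφ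
    rw [h1]
    exact analyticAt_comb_comp pl T Y (hG x hx)
  · obtain ⟨x, -, e, h1, -⟩ := hmem φ hφ
    rw [h1]
    exact e.symm

/-! ### Confinement by bars -/

theorem comb_sumElim {I J : Type} [Fintype I] [Fintype J] (pl : I → Fin n) (pl' : J → Fin n)
    (t : I → ℝ) (t' : J → ℝ) (y : EuclideanSpace ℝ (Fin n)) (ω : I ⊕ J → ℂ) :
    comb a (Sum.elim pl pl') (Sum.elim t t') y ω = comb a pl t y (ω ∘ Sum.inl) +
      ∑ j, t' j • planeEmb a (pl' j) (ω (Sum.inr j)) := by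
  simp only [comb, Fintype.sum_sum_type, Sum.elim_inl, Sum.elim_inr, Function.comp_apply]
  abel

theorem comb_sumElim_zero {I J : Type} [Fintype I] [Fintype J] (pl : I → Fin n) (pl' : J → Fin n)
    (t : I → ℝ) (y : EuclideanSpace ℝ (Fin n)) (ω : I ⊕ J → ℂ) :
    comb a (Sum.elim pl pl') (Sum.elim t 0) y ω = comb a pl t y (ω ∘ Sum.inl) := by
  rw [comb_sumElim]
  simp

/-- Two centres whose distances from a unit vector determine the vector. -/
noncomputable def confineCenter (s : Bool) : ℂ := if s then 2 else 2 * Complex.I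

theorem one_le_norm_sub_confineCenter {w : ℂ} (hw : ‖w‖ = 1) (s : Bool) :
    1 ≤ ‖w - confineCenter s‖ ∧ ‖w - confineCenter s‖ ≤ 3 := by
  have hc : ‖confineCenter s‖ = 2 := by cases s <;> simp [confineCenter]
  have h1 := norm_sub_norm_le (confineCenter s) w
  have h2 := norm_sub_le w (confineCenter s)
  rw [norm_sub_rev] at h1
  constructor <;> linarith

theorem norm_sub_sq_confineCenter {w : ℂ} (hw : ‖w‖ = 1) :
    ‖w - confineCenter true‖ ^ 2 = 5 - 4 * w.re ∧
      ‖w - confineCenter false‖ ^ 2 = 5 - 4 * w.im := by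
  rw [norm_eq_iff_normSq zero_le_one, Complex.normSq_apply] at hw
  rw [Complex.sq_norm, Complex.sq_norm, Complex.normSq_apply, Complex.normSq_apply]
  constructor
  · simp [confineCenter]
    linarith
  · simp [confineCenter]
    linarith

/-- The squared distances from `2` and `2 * i` are `5 - 4 * re w` and `5 - 4 * im w`. The distances
from `w₀` are at most `3`, so the squares change by at most `7 * ε` and each coordinate by at most
`2 * ε`. -/
theorem norm_sub_le_of_confined {w w₀ : ℂ} (hw : ‖w‖ = 1) (hw₀ : ‖w₀‖ = 1) {ε : ℝ} (hε : ε ≤ 1)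
    (h : ∀ s, |‖w - confineCenter s‖ - ‖w₀ - confineCenter s‖| ≤ ε) : ‖w - w₀‖ ≤ 4 * ε := by
  have hε0 : 0 ≤ ε := (abs_nonneg _).trans (h true)
  have key : ∀ s, |‖w - confineCenter s‖ ^ 2 - ‖w₀ - confineCenter s‖ ^ 2| ≤ 7 * ε := by
    intro s
    have h3 := (one_le_norm_sub_confineCenter hw₀ s).2
    have h4 := (abs_le.1 (h s)).2
    rw [sq_sub_sq, abs_mul, abs_of_nonneg (by positivity)]
    exact mul_le_mul (by linarith) (h s) (abs_nonneg _) (by norm_num)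
  have k1 := key true
  have k2 := key false
  rw [(norm_sub_sq_confineCenter hw).1, (norm_sub_sq_confineCenter hw₀).1] at k1
  rw [(norm_sub_sq_confineCenter hw).2, (norm_sub_sq_confineCenter hw₀).2] at k2
  have h5 := Complex.norm_le_abs_re_add_abs_im (w - w₀)
  rw [Complex.sub_re, Complex.sub_im] at h5
  have h6 : |w.re - w₀.re| ≤ 2 * ε := by
    rw [abs_le] at k1 ⊢
    constructor <;> linarith
  have h7 : |w.im - w₀.im| ≤ 2 * ε := by
    rw [abs_le] at k2 ⊢
    constructor <;> linarith
  linarith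

theorem dyadDisc_norm_pos {Y : ℂ} {ε : ℝ} (hε : 0 < ε) (h : ε < ‖Y‖) :
    0 < dyadDisc ‖Y‖ ε Y := by
  have hY : 0 < ‖Y‖ := hε.trans h
  have e : dyadDisc ‖Y‖ ε Y = 1 - (1 - ε ^ 2 / ‖Y‖ ^ 2 / 2) ^ 2 := by
    rw [dyadDisc, Complex.normSq_eq_norm_sq]
    field_simp
    ring
  have h1 : 0 < ε ^ 2 / ‖Y‖ ^ 2 := by positivity
  have h2 : ε ^ 2 / ‖Y‖ ^ 2 < 1 := by
    rw [div_lt_one (by positivity)]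
    gcongr
  rw [e]
  nlinarith

/-- An additional unit vector `ω'` with `‖len * ω' - (ω i - centre)‖ = ε` forces the distance of `ω
i` from the centre to within `ε` of `len`, its value at `ω₀`. Two centres per vector then confine
`ω`. Over `K`, `ω` is so near `ω₀` that each `ω'` has exactly two positions, and the sheets are the
choices of signs. -/
theorem exists_functional (hb : b ≠ a)
    (f : (Fin k → EuclideanSpace ℝ (Fin n)) → (Fin m → EuclideanSpace ℝ (Fin n)))
    (hf : IsPolynomialMap f) (K : Set (Fin k → EuclideanSpace ℝ (Fin n))) (hK : IsCompact K) :
    ∃ (V : Type) (_ : Fintype V) (L : CabledLinkage n V) (w : Fin k → V) (v : Fin m → V),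
      L.IsClassical ∧ Function.Injective (Sum.elim w v) ∧ L.IsFunctional w v f K := by
  classical
  obtain ⟨I, B, _, _, pl, con, cst, ω₀, ρ, hpl, hω₀, hρ, H⟩ := exists_planar_system hb f hf K hK
  -- The bound `ρ / 4` matches the factor in `norm_sub_le_of_confined`; the bound `1 / 2` keeps `ε`
  -- below every `len p`, so that the two circles cross at `ω₀`.
  let ε : ℝ := min (ρ / 4) (1 / 2)
  have hε : 0 < ε := lt_min (by positivity) (by norm_num)
  have hε1 : ε ≤ 1 / 2 := min_le_right _ _
  have hερ : 4 * ε ≤ ρ := by linarith [min_le_left (ρ / 4) (1 / 2 : ℝ)]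
  let len : I × Bool → ℝ := fun p => ‖ω₀ p.1 - confineCenter p.2‖
  have hlen1 : ∀ p, 1 ≤ len p := fun p => (one_le_norm_sub_confineCenter (hω₀ p.1) p.2).1
  have hlen : ∀ p, 0 < len p := fun p => one_pos.trans_le (hlen1 p)
  obtain ⟨ρ', hρ', hgood⟩ : ∃ ρ' > 0, ∀ ω : I → ℂ, ‖ω - ω₀‖ < ρ' → ∀ p : I × Bool,
      ω p.1 - confineCenter p.2 ≠ 0 ∧
        0 < dyadDisc (len p) ε (ω p.1 - confineCenter p.2) := by
    have : ∀ᶠ ω in 𝓝 ω₀, ∀ p : I × Bool, ω p.1 - confineCenter p.2 ≠ 0 ∧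
        0 < dyadDisc (len p) ε (ω p.1 - confineCenter p.2) := by
      rw [eventually_all]
      intro p
      have h1 : ω₀ p.1 - confineCenter p.2 ≠ 0 := norm_pos_iff.1 (hlen p)
      have hc : Continuous fun ω : I → ℂ => ω p.1 - confineCenter p.2 := by fun_prop
      have h2 : 0 < dyadDisc (len p) ε (ω₀ p.1 - confineCenter p.2) :=
        dyadDisc_norm_pos hε (by linarith [hlen1 p])
      refine (hc.continuousAt.eventually_ne h1).and ?_
      exact (ContinuousAt.comp (f := fun ω : I → ℂ => ω p.1 - confineCenter p.2)
        (analyticAt_dyadDisc (len p) ε h1).continuousAt hc.continuousAt).eventually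
        (lt_mem_nhds h2)
    obtain ⟨ρ', h1, h2⟩ := Metric.eventually_nhds_iff.1 this
    exact ⟨ρ', h1, fun ω hω => h2 (by rwa [dist_eq_norm])⟩
  obtain ⟨t, y, W, G, hKW, hG, hGn, hGc, hin, hout, huniq, hnear⟩ := H ρ' hρ'
  let pl' : I ⊕ (I × Bool) → Fin n := Sum.elim pl fun p => pl p.1
  have hpl' : ∀ i, pl' i ≠ a := by
    rintro (i | p)
    · exact hpl i
    · exact hpl p.1
  let con' : B ⊕ (I × Bool) → I ⊕ (I × Bool) → ℝ := Sum.elim (fun b => Sum.elim (con b) 0)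
    fun p => Sum.elim (Pi.single p.1 (-ε⁻¹)) (Pi.single p (len p / ε))
  let cst' : B ⊕ (I × Bool) → EuclideanSpace ℝ (Fin n) := Sum.elim cst
    fun p => ε⁻¹ • planeEmb a (pl p.1) (confineCenter p.2)
  have hslack : ∀ (ω : I ⊕ (I × Bool) → ℂ) p,
      ‖comb a pl' (con' (Sum.inr p)) (cst' (Sum.inr p)) ω‖ = 1
      ↔ ‖len p * ω (Sum.inr p) - (ω (Sum.inl p.1) - confineCenter p.2)‖ = ε := by
    intro ω p
    have : comb a pl' (con' (Sum.inr p)) (cst' (Sum.inr p)) ω = ε⁻¹ • planeEmb a (pl p.1)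
        (len p * ω (Sum.inr p) - (ω (Sum.inl p.1) - confineCenter p.2)) := by
      have e : (len p : ℂ) * ω (Sum.inr p) = len p • ω (Sum.inr p) := by simp
      refine (comb_sumElim pl (fun p : I × Bool => pl p.1) (Pi.single p.1 (-ε⁻¹))
        (Pi.single p (len p / ε)) (ε⁻¹ • planeEmb a (pl p.1) (confineCenter p.2)) ω).trans ?_
      rw [e, map_sub, map_sub, map_smul, smul_sub, smul_sub, smul_smul, div_eq_inv_mul]
      simp only [comb, Pi.single_apply, ite_smul, zero_smul, Finset.sum_ite_eq',
        Finset.mem_univ, if_true, Function.comp_apply, neg_smul]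
      abel
    rw [this, norm_smul, norm_planeEmb (hpl p.1), norm_inv, Real.norm_eq_abs, abs_of_pos hε,
      inv_mul_eq_one₀ hε.ne', eq_comm]
  obtain ⟨V, _, L, out, unit, T, Y, hclass, hinj, hTY, hunit, hconf⟩ :=
    exists_linkage_of_planar_system a pl' hpl' con' cst' (B' := Empty) Empty.elim Empty.elim
      (fun x => Sum.elim (t x) 0) y
  have hmem : ∀ φ ∈ L.configSpace, ∃ x ∈ W, ∃ ω : I ⊕ (I × Bool) → ℂ, (∀ i, ‖ω i‖ = 1) ∧
      (ω ∘ Sum.inl = G x) ∧ (∀ p, ‖len p * ω (Sum.inr p) - (G x p.1 - confineCenter p.2)‖ = ε) ∧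
      φ = (fun v => comb a pl' (T v) (Y v) ω) ∧
      L.eval (out ∘ Sum.inl) φ = x ∧ L.eval (out ∘ Sum.inr) φ = f x := by
    intro φ hφ
    rw [hconf] at hφ
    obtain ⟨ω, h1, h2, -, rfl⟩ := hφ
    have h3 : ∀ p, ‖len p * ω (Sum.inr p) - (ω (Sum.inl p.1) - confineCenter p.2)‖ = ε :=
      fun p => (hslack ω p).1 (h2 (Sum.inr p))
    have h4 : ‖ω ∘ Sum.inl - ω₀‖ ≤ ρ := by
      rw [pi_norm_le_iff_of_nonneg hρ.le]
      intro i
      refine le_trans (norm_sub_le_of_confined (h1 _) (hω₀ i) (by linarith) fun s => ?_) hερ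
      have h5 := abs_norm_sub_norm_le (len (i, s) * ω (Sum.inr (i, s)))
        (ω (Sum.inl i) - confineCenter s)
      rw [h3 (i, s), norm_mul, h1, mul_one, Complex.norm_real, Real.norm_eq_abs,
        abs_of_pos (hlen (i, s)), abs_sub_comm] at h5
      exact h5
    obtain ⟨x, hx, e⟩ := huniq (ω ∘ Sum.inl) (fun i => h1 _) (fun b => by
      rw [← comb_sumElim_zero pl (fun p : I × Bool => pl p.1)]; exact h2 (Sum.inl b)) h4
    have hcomb : ∀ z, comb a pl' (T (out z)) (Y (out z)) ω = comb a pl (t z) (y z) (G x) := by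
      intro z
      rw [hTY]
      exact (comb_sumElim_zero _ _ _ _ _).trans (by rw [e])
    refine ⟨x, hx, ω, h1, e, fun p => ?_, rfl, funext fun l => (hcomb _).trans (hin x hx l),
      funext fun l => (hcomb _).trans (hout x hx l)⟩
    rw [← e]
    exact h3 p
  let sgn : Bool → ℝ := fun s => if s then 1 else -1
  have hsgn : ∀ s, sgn s = 1 ∨ sgn s = -1 := by intro s; cases s <;> simp [sgn]
  let Ω : (I × Bool → Bool) → (Fin k → EuclideanSpace ℝ (Fin n)) → I ⊕ (I × Bool) → ℂ :=
    fun σ x => Sum.elim (G x)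
      fun p => dyad (len p) ε (sgn (σ p)) (G x p.1 - confineCenter p.2)
  let sec : (I × Bool → Bool) → (Fin k → EuclideanSpace ℝ (Fin n)) → V →
      EuclideanSpace ℝ (Fin n) := fun σ x v => comb a pl' (T v) (Y v) (Ω σ x)
  have hsecC : ∀ σ, ∀ x ∈ K, sec σ x ∈ L.configSpace := by
    intro σ x hx
    have hg := hgood (G x) (hnear x hx)
    rw [hconf]
    refine ⟨Ω σ x, ?_, ?_, fun b => b.elim, rfl⟩
    · rintro (i | p)
      · exact hGn x (hKW hx) i
      · exact norm_dyad (hg p).1 (hlen p) (hsgn _) (hg p).2.le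
    · rintro (b | p)
      · exact (congrArg norm (comb_sumElim_zero pl (fun p : I × Bool => pl p.1) (con b) (cst b)
          (Ω σ x))).trans (hGc x (hKW hx) b)
      · exact (hslack _ p).2 (norm_mul_dyad_sub (hg p).1 (hlen p) hε (hsgn _) (hg p).2.le)
  have hsecq : ∀ σ, ∀ x ∈ K, L.eval (out ∘ Sum.inl) (sec σ x) = x := by
    intro σ x hx
    funext l
    refine (hTY (Sum.inl l) (Ω σ x)).trans ?_
    exact (comb_sumElim_zero _ _ _ _ _).trans (hin x (hKW hx) l)
  refine ⟨V, inferInstance, L, out ∘ Sum.inl, out ∘ Sum.inr, hclass inferInstance, ?_,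
    fun φ hφ => ?_, fun x hx => ⟨sec (fun _ => true) x, hsecC _ x hx, hsecq _ x hx⟩,
    isAnalyticallyTrivialCover_of_sections (analyticAt_eval L _) hK sec (fun σ x hx => ?_) hsecC
      hsecq (fun φ hφ hφK => ?_) fun x hx σ σ' hσ h => ?_⟩
  · rwa [Sum.elim_comp_inl_inr]
  · obtain ⟨x, -, ω, -, -, -, -, h1, h2⟩ := hmem φ hφ
    rw [h1, h2]
  · refine analyticAt_comb_comp pl' T Y (AnalyticAt.pi ?_)
    have hg := hgood (G x) (hnear x hx)
    have hGi : ∀ i, AnalyticAt ℝ (fun x => G x i) x := fun i =>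
      ((ContinuousLinearMap.proj (R := ℝ) (φ := fun _ : I => ℂ) i).analyticAt _).comp
        (hG x (hKW hx))
    rintro (i | p)
    · exact hGi i
    · exact AnalyticAt.comp (f := fun x => G x p.1 - confineCenter p.2)
        (analyticAt_dyad (sgn (σ p)) (hg p).1 (hg p).2) ((hGi p.1).sub analyticAt_const)
  · obtain ⟨x, -, ω, h1, h2, h3, h4, h5, -⟩ := hmem φ hφ
    rw [h5] at hφK ⊢
    have hg := hgood (G x) (hnear x hφK)
    have : ∀ p, ∃ s, ω (Sum.inr p) = dyad (len p) ε (sgn s) (G x p.1 - confineCenter p.2) := by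
      intro p
      rcases eq_dyad_or_eq_dyad (hg p).1 (hlen p) hε (h1 _) (h3 p) with h | h
      · exact ⟨true, h⟩
      · exact ⟨false, h⟩
    choose σ hσ using this
    refine ⟨σ, ?_⟩
    have e : ω = Ω σ x := by
      funext i
      rcases i with i | p
      · exact congrFun h2 i
      · exact hσ p
    rw [h4, e]
  · have hg := hgood (G x) (hnear x hx)
    obtain ⟨p, hp⟩ := Function.ne_iff.1 hσ
    -- The additional unit vector is itself a vertex of the linkage, so different signs give
    -- different configurations.
    have e := congrFun h (unit (Sum.inr p))
    simp only [sec, hunit] at e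
    have e2 := planeEmb_injective (hpl p.1) e
    have hs : sgn (σ' p) = -sgn (σ p) := by
      revert hp
      cases σ p <;> cases σ' p <;> simp [sgn]
    refine dyad_ne_dyad (hg p).1 (hlen p) (hsgn (σ p)) (hg p).2 ?_
    rw [← hs]
    exact e2

end Main

theorem mainTheorem3 (n k m : ℕ) (hn : 2 ≤ n)
    (f : (Fin k → EuclideanSpace ℝ (Fin n)) → (Fin m → EuclideanSpace ℝ (Fin n)))
    (hf : IsPolynomialMap f)
    (K : Set (Fin k → EuclideanSpace ℝ (Fin n))) (hK : IsCompact K) :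
    (∃ (V : Type) (_ : Fintype V) (L : CabledLinkage n V) (w : Fin k → V) (v : Fin m → V),
      L.IsClassical ∧ Function.Injective (Sum.elim w v) ∧ L.IsFunctional w v f K) ∧
    (∃ (V : Type) (_ : Fintype V) (L : CabledLinkage n V) (w : Fin k → V) (v : Fin m → V),
      Function.Injective (Sum.elim w v) ∧ L.IsStronglyFunctional w v f K) := by
  have hb : (⟨1, by omega⟩ : Fin n) ≠ ⟨0, by omega⟩ := by simp
  exact ⟨exists_functional hb f hf K hK, exists_stronglyFunctional hb f hf K hK⟩
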